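/- Let $d\ge 2$. A walk of length $n$ is a map $\gamma:\{0,\dots,n\}\to\mathbb Z^d$ whose consecutive values are nearest neighbours in $\mathbb Z^d$; it is self-avoiding if it is injective. Write $|\gamma|=n$ for its length, $y(u)=u_2$ for the second coordinate of $u\in\mathbb Z^d$, and $\mathrm{SAW}_n$ for the set of self-avoiding walks of length $n$ with $\gamma_0=0$. Let $\mu_c=\lim_{n}|\mathrm{SAW}_n|^{1/n}$ be the connective constant. A self-avoiding walk $\gamma$ of length $n$ is a bridge if $y(\gamma_0)<y(\gamma_j)$ for all $0<j\le n$ and $y(\gamma_j)\le y(\gamma_n)$ for all $0\le j\le n$. Let $\mathrm{SAB}_n$ be the set of bridges of length $n$ with $\gamma_0=0$, and let $\mathsf P_{\mathrm{SAB}_n}$ be the uniform law on it. A renewal point of $\gamma\in\mathrm{SAB}_n$ is a point $\gamma_i$, $0\le i\le n$, such that $\gamma[0,i]$ and $\gamma[i,n]$ are both bridges. A bridge $\gamma\in \mathrm{SAB}_n$ with $n\ge1$ is irreducible if $\gamma_k$ is not a renewal point for any $1\le k\le n-1$. Let $\mathrm{iSAB}$ be the set of irreducible bridges of arbitrary length with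 $\gamma_0=0$, and let $\mathbb P_{\mathrm{iSAB}}$ be the law on $\mathrm{iSAB}$ given by $\mathbb P_{\mathrm{iSAB}}(\gamma)=\mu_c^{-|\gamma|}$, with expectation $\mathbb E_{\mathrm{iSAB}}$. Suppose that the ballistic assumption holds: for some $v>0$, $$\limsup_{n\to\infty}\, n^{-1}\log \mathsf P_{\mathrm{SAB}_n}\big(y(\gamma_n)\ge vn\big)=0,$$ where $\log 0=-\infty$. Then $$\mathbb E_{\mathrm{iSAB}}(|\gamma|)=\sum_{\gamma\in\mathrm{iSAB}}|\gamma|\,\mu_c^{-|\gamma|}<\infty .$$ -/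

import Mathlib

open MeasureTheory ProbabilityTheory Filter Topology
open scoped ENNReal

namespace SelfAvoiding

/-- `{u, v}` is a nearest-neighbour bond of the integer lattice `ℤ^d`. -/
def IsBond {d : ℕ} (u v : Fin d → ℤ) : Prop := ∑ i, |u i - v i| = 1

/-- The second coordinate `y(u) = u₂` (coordinates are indexed from `0` in `Fin d`). -/
def y {d : ℕ} (hd : 2 ≤ d) (u : Fin d → ℤ) : ℤ := u ⟨1, hd⟩

/-- The set of self-avoiding walks of length `n` in `ℤ^d` that start at `0`. -/
def SAW (d n : ℕ) : Set (Fin (n + 1) → Fin d → ℤ) :=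
  {γ | γ 0 = 0 ∧ (∀ i : Fin n, IsBond (γ i.castSucc) (γ i.succ)) ∧ Function.Injective γ}

/-- The connective constant `lim_n |SAW_n|^{1/n}`. -/
noncomputable def connectiveConstant (d : ℕ) : ℝ :=
  limUnder atTop fun n : ℕ => ((SAW d n).ncard : ℝ) ^ (1 / (n : ℝ))

/-- The portion `γ[a,b]` of the self-avoiding walk `γ` is a bridge: its first element is the
unique one of minimal `y`-coordinate, and its last element has maximal `y`-coordinate. -/
def IsBridgeOn {d : ℕ} (hd : 2 ≤ d) {n : ℕ} (γ : Fin (n + 1) → Fin d → ℤ)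
    (a b : Fin (n + 1)) : Prop :=
  (∀ j, a < j → j ≤ b → y hd (γ a) < y hd (γ j)) ∧
    ∀ j, a ≤ j → j ≤ b → y hd (γ j) ≤ y hd (γ b)

/-- The set of self-avoiding bridges of length `n` that start at `0`. -/
def SAB {d : ℕ} (hd : 2 ≤ d) (n : ℕ) : Set (Fin (n + 1) → Fin d → ℤ) :=
  {γ | γ ∈ SAW d n ∧ IsBridgeOn hd γ 0 (Fin.last n)}

/-- The uniform law on the bridges of length `n`. -/
noncomputable def lawSAB {d : ℕ} (hd : 2 ≤ d) (n : ℕ) : Measure (Fin (n + 1) → Fin d → ℤ) :=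
  uniformOn (SAB hd n)

/-- The renewal points of `γ`: the points `γ i` such that `γ[0,i]` and `γ[i,n]` are bridges. -/
def renewalPoints {d : ℕ} (hd : 2 ≤ d) {n : ℕ} (γ : Fin (n + 1) → Fin d → ℤ) :
    Set (Fin d → ℤ) :=
  {u | ∃ i, γ i = u ∧ IsBridgeOn hd γ 0 i ∧ IsBridgeOn hd γ i (Fin.last n)}

/-- A walk of length `n ≥ 1` none of whose intermediate points is a renewal point. -/
def IsIrreducible {d : ℕ} (hd : 2 ≤ d) {n : ℕ} (γ : Fin (n + 1) → Fin d → ℤ) : Prop :=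
  1 ≤ n ∧ ∀ k : Fin (n + 1), 1 ≤ (k : ℕ) → (k : ℕ) ≤ n - 1 → γ k ∉ renewalPoints hd γ

/-- The set of irreducible bridges, of arbitrary length, that start at `0`. -/
def ISAB {d : ℕ} (hd : 2 ≤ d) : Type :=
  {γ : Σ n : ℕ, (Fin (n + 1) → Fin d → ℤ) // γ.2 ∈ SAB hd γ.1 ∧ IsIrreducible hd γ.2}

/-- The length (number of edges) of an irreducible bridge. -/
def ISAB.length {d : ℕ} {hd : 2 ≤ d} (γ : ISAB hd) : ℕ := γ.1.1

instance {d : ℕ} (hd : 2 ≤ d) : MeasurableSpace (ISAB hd) := ⊤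

/-- The law on irreducible bridges that gives mass `μ_c ^ (-|γ|)` to each bridge `γ`. -/
noncomputable def lawISAB {d : ℕ} (hd : 2 ≤ d) : Measure (ISAB hd) :=
  Measure.sum fun γ : ISAB hd =>
    ENNReal.ofReal ((connectiveConstant d)⁻¹ ^ γ.length) • Measure.dirac γ

/-- For some `v > 0`, `limsup_n n⁻¹ log P_{SAB_n}(y(γ_n) ≥ v n) = 0`. The logarithm takes
values in the extended reals, with `log 0 = -∞`. -/
def BallisticAssumption {d : ℕ} (hd : 2 ≤ d) : Prop :=
  ∃ v : ℝ, 0 < v ∧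
    limsup (fun n : ℕ => (n : EReal)⁻¹ *
      ENNReal.log (lawSAB hd n {γ | v * n ≤ (y hd (γ (Fin.last n)) : ℝ)})) atTop = 0

end SelfAvoiding

/-! The contrapositive is the core: if irreducible bridges have infinite mean length, then for each
`v > 0` the bridges of height at least `v n` form an exponentially small proportion of all bridges.
Weights are taken at the growth rate `β = bridgeRate` of bridges. Only `β ≤ log μ_c` is needed to
return to the weights `μ_c ^ (-|γ|)`.

From infinite mean to few renewals (`isExpSmall_renewals`): the generating function of irreducible
bridges is at most `1` at `exp (-β)`, by `sum_irreducibles_le_one`. An infinite mean makes it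
infinitely steep there, so at `exp (-(β + l))` it is at most `1 - 2 l / δ` for some small `l`. A
bridge with `r` renewal times is a chain of `r` irreducible ones, so for each `r ≥ δ n` there are at
most `exp ((β - l) n)` of them.

From few renewals to small height (`isExpSmall_ballistic`): a bridge of height `v n` has linearly
many levels that are visited at most `k` times, `k` depending only on `v`. A level that is not a
renewal height is spanned by a fold, a stretch on which the walk goes back down. Reflecting all
folds turns each such level into another one, visited at least once less (`card_lowLevels_le`).
Induction on `k` then ends at levels never visited, of which there are none.

The induction needs the unfolding to respect exponential smallness. With few folds it merges few
bridges, since the folds can be recovered from their endpoints (`IsExpSmall.unfold_few`). With many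
folds but few renewals, each bridge has far more choices of a small set of short folds to unfold
than an unfolded bridge has preimages: the endpoints of the unfolded folds become renewal times, and
few other renewal times arise. Hence such bridges are rare (`isExpSmall_many_folds`). -/

namespace SelfAvoiding

/-! ### Height profiles, renewal times and folds -/

/-- The height profile `h` of a bridge of length `n`. -/
structure IsProfile (n : ℕ) (h : ℕ → ℤ) : Prop where
  step : ∀ i, |h (i + 1) - h i| ≤ 1
  zero : h 0 = 0
  pos : ∀ j, 0 < j → j ≤ n → 0 < h j
  le_last : ∀ j ≤ n, h j ≤ h n

/-- The time `i < n` is a renewal time of the profile `h`. -/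
def IsRenewal (n : ℕ) (h : ℕ → ℤ) (i : ℕ) : Prop :=
  i < n ∧ (∀ j ≤ i, h j ≤ h i) ∧ ∀ j, i < j → j ≤ n → h i < h j

open Classical in
/-- The renewal times of the profile `h` before time `n`. -/
noncomputable def renewals (n : ℕ) (h : ℕ → ℤ) : Finset ℕ :=
  (Finset.range n).filter (IsRenewal n h)

lemma mem_renewals {n : ℕ} {h : ℕ → ℤ} {i : ℕ} : i ∈ renewals n h ↔ IsRenewal n h i := by
  simp only [renewals, Finset.mem_filter, Finset.mem_range, and_iff_right_iff_imp]
  exact fun hi => hi.1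

/-- A fold: `a` is the last maximum of `h` on `[0,b]` and `b` the last minimum of `h` on `[a,n]`. -/
structure IsFold (n : ℕ) (h : ℕ → ℤ) (a b : ℕ) : Prop where
  lt : a < b
  le : b ≤ n
  le_left : ∀ j ≤ b, h j ≤ h a
  lt_left : ∀ j, a < j → j ≤ b → h j < h a
  right_le : ∀ j, a ≤ j → j ≤ n → h b ≤ h j
  right_lt : ∀ j, b < j → j ≤ n → h b < h j

open Classical in
/-- The folds of the profile `h`. -/
noncomputable def folds (n : ℕ) (h : ℕ → ℤ) : Finset (ℕ × ℕ) :=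
  ((Finset.range (n + 1)) ×ˢ (Finset.range (n + 1))).filter fun p => IsFold n h p.1 p.2

lemma mem_folds {n : ℕ} {h : ℕ → ℤ} {p : ℕ × ℕ} : p ∈ folds n h ↔ IsFold n h p.1 p.2 := by
  simp only [folds, Finset.mem_filter, Finset.mem_product, Finset.mem_range,
    and_iff_right_iff_imp]
  intro hp
  have := hp.lt
  have := hp.le
  omega

/-- A second left end `a'` in `(a, b]` would lie strictly below `h a`, yet be a maximum over a range
that contains `a`. -/
lemma IsFold.lt_of_lt {n : ℕ} {h : ℕ → ℤ} {a b a' b' : ℕ} (H : IsFold n h a b)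
    (H' : IsFold n h a' b') (haa : a < a') : b < a' := by
  by_contra! hc
  have h1 := H.lt_left a' haa hc
  have h2 := H'.le_left a (by have := H'.lt; omega)
  omega

lemma IsFold.right_eq {n : ℕ} {h : ℕ → ℤ} {a b b' : ℕ} (H : IsFold n h a b)
    (H' : IsFold n h a b') : b = b' := by
  rcases lt_trichotomy b b' with hb | hb | hb
  · have h1 := H.right_lt b' hb H'.le
    have h2 := H'.right_le b H.lt.le H.le
    omega
  · exact hb
  · have h1 := H'.right_lt b hb H.le
    have h2 := H.right_le b' H'.lt.le H'.le
    omega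

/-- Folds are pairwise disjoint, so they can be unfolded independently and either endpoint
identifies a fold. -/
lemma IsFold.cases {n : ℕ} {h : ℕ → ℤ} {p q : ℕ × ℕ} (H : IsFold n h p.1 p.2)
    (H' : IsFold n h q.1 q.2) : p = q ∨ p.2 < q.1 ∨ q.2 < p.1 := by
  rcases lt_trichotomy p.1 q.1 with hb | hb | hb
  · exact Or.inr (Or.inl (H.lt_of_lt H' hb))
  · left
    obtain ⟨a, b⟩ := p
    obtain ⟨a', b'⟩ := q
    simp only at hb
    subst hb
    exact congrArg (Prod.mk a) (H.right_eq H')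
  · exact Or.inr (Or.inr (H'.lt_of_lt H hb))

lemma IsFold.lt_length {n : ℕ} {h : ℕ → ℤ} {a b : ℕ} (hp : IsProfile n h) (H : IsFold n h a b) :
    b < n := by
  rcases H.le.lt_or_eq with h1 | h1
  · exact h1
  · subst h1
    have := H.lt_left b H.lt le_rfl
    have := hp.le_last a H.lt.le
    omega

lemma IsFold.height_pos {n : ℕ} {h : ℕ → ℤ} {a b : ℕ} (H : IsFold n h a b) : h b < h a :=
  H.lt_left b H.lt le_rfl

lemma abs_sub_le_of_step {h : ℕ → ℤ} (hs : ∀ i, |h (i + 1) - h i| ≤ 1) {a b : ℕ} (hab : a ≤ b) :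
    |h b - h a| ≤ b - a := by
  induction b, hab using Nat.le_induction with
  | base => simp
  | succ b hb ih =>
    have := hs b
    rw [abs_le] at *
    push_cast
    omega

/-- Discrete intermediate value theorem. -/
lemma exists_eq_of_step {h : ℕ → ℤ} (hs : ∀ i, |h (i + 1) - h i| ≤ 1) {l : ℤ} {c : ℕ}
    (h0 : h 0 ≤ l) (hc : l ≤ h c) : ∃ i ≤ c, h i = l := by
  induction c with
  | zero => exact ⟨0, le_rfl, le_antisymm h0 hc⟩
  | succ c ih =>
    by_cases h1 : l ≤ h c
    · obtain ⟨i, hi, e⟩ := ih h1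
      exact ⟨i, by omega, e⟩
    · refine ⟨c + 1, le_rfl, ?_⟩
      have := hs c
      rw [abs_le] at this
      omega

lemma exists_last_min (h : ℕ → ℤ) (p n : ℕ) (hpn : p ≤ n) :
    ∃ b, p ≤ b ∧ b ≤ n ∧ (∀ j, p ≤ j → j ≤ n → h b ≤ h j) ∧ ∀ j, b < j → j ≤ n → h b < h j := by
  induction n, hpn using Nat.le_induction with
  | base => exact ⟨p, le_rfl, le_rfl, fun j h1 h2 => by rw [le_antisymm h1 h2],
      fun j h1 h2 => by omega⟩
  | succ n hn ih =>
    obtain ⟨b, h1, h2, h3, h4⟩ := ih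
    by_cases hb : h b < h (n + 1)
    · refine ⟨b, h1, by omega, fun j hj hj' => ?_, fun j hj hj' => ?_⟩
      · rcases hj'.lt_or_eq with h5 | h5
        · exact h3 j hj (by omega)
        · rw [h5]; exact hb.le
      · rcases hj'.lt_or_eq with h5 | h5
        · exact h4 j hj (by omega)
        · rw [h5]; exact hb
    · refine ⟨n + 1, by omega, le_rfl, fun j hj hj' => ?_, fun j hj hj' => by omega⟩
      rcases hj'.lt_or_eq with h5 | h5
      · have := h3 j hj (by omega)
        omega
      · rw [h5]

lemma exists_last_max (h : ℕ → ℤ) (n : ℕ) :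
    ∃ a, a ≤ n ∧ (∀ j, j ≤ n → h j ≤ h a) ∧ ∀ j, a < j → j ≤ n → h j < h a := by
  obtain ⟨b, -, h2, h3, h4⟩ := exists_last_min (fun i => -h i) 0 n (Nat.zero_le n)
  refine ⟨b, h2, fun j hj => ?_, fun j hj hj' => ?_⟩
  · have := h3 j (Nat.zero_le j) hj
    omega
  · have := h4 j hj hj'
    omega

/-- A level below the top is either the height of a renewal time or is spanned by a fold. -/
lemma exists_renewal_or_fold {n : ℕ} {h : ℕ → ℤ} (hp : IsProfile n h) {l : ℤ} (hl0 : 0 ≤ l)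
    (hln : l < h n) :
    (∃ i, IsRenewal n h i ∧ h i = l) ∨ ∃ a b, IsFold n h a b ∧ h b ≤ l ∧ l < h a := by
  classical
  have hex : ∃ p, l < h p := ⟨n, hln⟩
  -- `p` is the first time above level `l`, and `b` the last minimum after it. If the profile
  -- returns to `l` or below, `b` ends a fold that starts at the last maximum on `[0, b]`; otherwise
  -- `p - 1` is a renewal time at height `l`.
  set p := Nat.find hex with hpdef
  have hp1 : l < h p := Nat.find_spec hex
  have hpn : p ≤ n := Nat.find_min' hex hln
  have hmin : ∀ j < p, h j ≤ l := fun j hj => not_lt.1 (Nat.find_min hex hj)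
  obtain ⟨b, hb1, hb2, hb3, hb4⟩ := exists_last_min h p n hpn
  by_cases hbl : h b ≤ l
  · right
    obtain ⟨a, ha1, ha2, ha3⟩ := exists_last_max h b
    have hap : l < h a := hp1.trans_le (ha2 p hb1)
    have hpa : p ≤ a := by
      by_contra! hc
      have := hmin a hc
      omega
    refine ⟨a, b, ⟨lt_of_le_of_ne ha1 ?_, hb2, ha2, ha3, fun j hj => hb3 j (hpa.trans hj), hb4⟩,
      hbl, hap⟩
    rintro rfl
    omega
  · left
    have hp0 : p ≠ 0 := by
      intro h0
      rw [h0, hp.zero] at hp1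
      omega
    obtain ⟨i, hi⟩ := Nat.exists_eq_succ_of_ne_zero hp0
    have hil : h i = l := by
      have h1 := hmin i (by omega)
      have h2 := hp.step i
      rw [abs_le] at h2
      have h3 : h (i + 1) = h p := by rw [hi]
      omega
    refine ⟨i, ⟨by omega, fun j hj => ?_, fun j hj hj' => ?_⟩, hil⟩
    · rw [hil]; exact hmin j (by omega)
    · have := hb3 j (by omega) hj'
      omega

/-! ### Flipping the increments of a profile -/

/-- The profile whose increments are those of `h` multiplied by the signs `σ`. -/
def flip (σ : ℕ → ℤ) (h : ℕ → ℤ) (j : ℕ) : ℤ :=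
  h 0 + ∑ i ∈ Finset.range j, σ i * (h (i + 1) - h i)

lemma flip_zero (σ h : ℕ → ℤ) : flip σ h 0 = h 0 := by simp [flip]

lemma flip_succ (σ h : ℕ → ℤ) (j : ℕ) :
    flip σ h (j + 1) = flip σ h j + σ j * (h (j + 1) - h j) := by
  simp [flip, Finset.sum_range_succ, add_assoc]

lemma flip_flip (σ τ h : ℕ → ℤ) : flip τ (flip σ h) = flip (fun i => τ i * σ i) h := by
  funext j
  induction j with
  | zero => simp [flip_zero]
  | succ j ih => rw [flip_succ, ih, flip_succ σ, flip_succ]; ring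

lemma flip_one (h : ℕ → ℤ) : flip (fun _ => 1) h = h := by
  funext j
  induction j with
  | zero => simp [flip_zero]
  | succ j ih => rw [flip_succ, ih]; ring

lemma flip_const_neg {σ h : ℕ → ℤ} {a b : ℕ} (hσ : ∀ i, a ≤ i → i < b → σ i = -1) {j : ℕ}
    (haj : a ≤ j) (hjb : j ≤ b) : flip σ h j = flip σ h a + h a - h j := by
  induction j, haj using Nat.le_induction with
  | base => ring
  | succ j hj ih => rw [flip_succ, ih (by omega), hσ j hj (by omega)]; ring

lemma flip_const_pos {σ h : ℕ → ℤ} {a b : ℕ} (hσ : ∀ i, a ≤ i → i < b → σ i = 1) {j : ℕ}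
    (haj : a ≤ j) (hjb : j ≤ b) : flip σ h j = flip σ h a - h a + h j := by
  induction j, haj using Nat.le_induction with
  | base => ring
  | succ j hj ih => rw [flip_succ, ih (by omega), hσ j hj (by omega)]; ring

/-- The signs that reflect the increments on `[a,b)`. -/
def foldSign (a b i : ℕ) : ℤ := if a ≤ i ∧ i < b then -1 else 1

/-- The signs that reflect the increments on all the intervals in `S`. -/
def foldSigns (S : Finset (ℕ × ℕ)) (i : ℕ) : ℤ := ∏ p ∈ S, foldSign p.1 p.2 i

lemma foldSign_cases (a b i : ℕ) : foldSign a b i = 1 ∨ foldSign a b i = -1 := by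
  unfold foldSign; split_ifs <;> simp

lemma foldSign_mul_self (a b i : ℕ) : foldSign a b i * foldSign a b i = 1 := by
  unfold foldSign; split_ifs <;> simp

lemma foldSigns_mul_self (S : Finset (ℕ × ℕ)) (i : ℕ) : foldSigns S i * foldSigns S i = 1 := by
  rw [foldSigns, ← Finset.prod_mul_distrib]
  exact Finset.prod_eq_one fun p _ => foldSign_mul_self _ _ _

lemma flip_insert (h : ℕ → ℤ) {S : Finset (ℕ × ℕ)} {p : ℕ × ℕ} (hp : p ∉ S) :
    flip (foldSigns (insert p S)) h = flip (foldSign p.1 p.2) (flip (foldSigns S) h) := by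
  rw [flip_flip]
  congr 1
  funext i
  rw [foldSigns, Finset.prod_insert hp, foldSigns]

/-! ### Unfolding a single fold -/

section Single

variable {h : ℕ → ℤ} {a b : ℕ}

lemma flip_foldSign_left {j : ℕ} (hj : j ≤ a) : flip (foldSign a b) h j = h j := by
  rw [flip_const_pos (a := 0) (b := a) _ (Nat.zero_le j) hj, flip_zero]
  · ring
  · intro i _ hi
    rw [foldSign, if_neg (by omega)]

lemma flip_foldSign_mid {j : ℕ} (hj : a ≤ j) (hjb : j ≤ b) :
    flip (foldSign a b) h j = 2 * h a - h j := by
  rw [flip_const_neg (a := a) (b := b) _ hj hjb, flip_foldSign_left le_rfl]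
  · ring
  · intro i h1 h2
    rw [foldSign, if_pos ⟨h1, h2⟩]

lemma flip_foldSign_right (hab : a ≤ b) {j : ℕ} (hj : b ≤ j) :
    flip (foldSign a b) h j = h j + 2 * (h a - h b) := by
  rw [flip_const_pos (a := b) (b := j) _ hj le_rfl, flip_foldSign_mid hab le_rfl]
  · ring
  · intro i h1 h2
    rw [foldSign, if_neg (by omega)]

variable {n : ℕ}

lemma IsFold.le_flip (H : IsFold n h a b) (j : ℕ) :
    h j ≤ flip (foldSign a b) h j := by
  rcases le_total j a with h1 | h1
  · rw [flip_foldSign_left h1]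
  rcases le_total j b with h2 | h2
  · rw [flip_foldSign_mid h1 h2]
    have := H.le_left j h2
    omega
  · rw [flip_foldSign_right H.lt.le h2]
    have := H.height_pos
    omega

lemma IsFold.flip_lt_left (H : IsFold n h a b) {j : ℕ} (hj : a < j) (hjn : j ≤ n) :
    h a < flip (foldSign a b) h j := by
  rcases le_total j b with h2 | h2
  · rw [flip_foldSign_mid hj.le h2]
    have := H.lt_left j hj h2
    omega
  · rw [flip_foldSign_right H.lt.le h2]
    have := H.height_pos
    have := H.right_le j hj.le hjn
    omega

lemma IsFold.flip_le_right (H : IsFold n h a b) {j : ℕ} (hj : j ≤ b) :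
    flip (foldSign a b) h j ≤ flip (foldSign a b) h b := by
  rw [flip_foldSign_right H.lt.le le_rfl]
  have := H.height_pos
  rcases le_total j a with h1 | h1
  · rw [flip_foldSign_left h1]
    have := H.le_left j hj
    omega
  · rw [flip_foldSign_mid h1 hj]
    have := H.right_le j h1 (hj.trans H.le)
    omega

lemma IsFold.flip_right_lt (H : IsFold n h a b) {j : ℕ} (hj : b < j) (hjn : j ≤ n) :
    flip (foldSign a b) h b < flip (foldSign a b) h j := by
  rw [flip_foldSign_right H.lt.le le_rfl, flip_foldSign_right H.lt.le hj.le]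
  have := H.right_lt j hj hjn
  omega

lemma IsFold.isProfile_flip (H : IsFold n h a b) (hp : IsProfile n h) :
    IsProfile n (flip (foldSign a b) h) where
  step i := by
    rw [flip_succ, add_sub_cancel_left, abs_mul]
    rcases foldSign_cases a b i with h1 | h1 <;> rw [h1] <;> simpa using hp.step i
  zero := by rw [flip_zero, hp.zero]
  pos j hj hjn := (hp.pos j hj hjn).trans_le (H.le_flip j)
  le_last j hjn := by
    rcases le_total j b with h2 | h2
    · exact (H.flip_le_right h2).trans (H.flip_right_lt (H.lt_length hp) le_rfl).le
    · rw [flip_foldSign_right H.lt.le h2, flip_foldSign_right H.lt.le H.le]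
      have := hp.le_last j hjn
      omega

lemma IsFold.isRenewal_left (H : IsFold n h a b) :
    IsRenewal n (flip (foldSign a b) h) a := by
  refine ⟨H.lt.trans_le H.le, fun j hj => ?_, fun j hj hjn => ?_⟩
  · rw [flip_foldSign_left hj, flip_foldSign_left le_rfl]
    exact H.le_left j (hj.trans H.lt.le)
  · rw [flip_foldSign_left le_rfl]
    exact H.flip_lt_left hj hjn

lemma IsFold.isRenewal_right (H : IsFold n h a b) (hp : IsProfile n h) :
    IsRenewal n (flip (foldSign a b) h) b :=
  ⟨H.lt_length hp, fun _ hj => H.flip_le_right hj, fun _ hj hjn => H.flip_right_lt hj hjn⟩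

/-- A renewal time cannot lie in `[a, b)`, because the profile is lower at `b` than at `a`. Before
`a` the later heights only increase; from `b` on the profile is merely translated. -/
lemma IsFold.isRenewal_flip (H : IsFold n h a b) {c : ℕ} (hc : IsRenewal n h c) :
    IsRenewal n (flip (foldSign a b) h) c := by
  obtain ⟨h1, h2, h3⟩ := hc
  refine ⟨h1, ?_⟩
  have hab := H.lt
  have hbn := H.le
  have hpos := H.height_pos
  rcases lt_or_ge c a with hca | hca
  · refine ⟨fun j hj => ?_, fun j hj hjn => ?_⟩
    · rw [flip_foldSign_left (hj.trans hca.le), flip_foldSign_left hca.le]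
      exact h2 j hj
    · rw [flip_foldSign_left hca.le]
      exact (h3 j hj hjn).trans_le (H.le_flip j)
  · have hbc : b ≤ c := by
      by_contra! hcb
      have := h3 b hcb hbn
      have := H.right_le c hca (by omega)
      have := h2 a hca
      omega
    refine ⟨fun j hj => ?_, fun j hj hjn => ?_⟩
    · rcases le_total j b with h5 | h5
      · refine (H.flip_le_right h5).trans ?_
        rw [flip_foldSign_right hab.le le_rfl, flip_foldSign_right hab.le hbc]
        have := h2 b hbc
        omega
      · rw [flip_foldSign_right hab.le h5, flip_foldSign_right hab.le hbc]
        have := h2 j hj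
        omega
    · rw [flip_foldSign_right hab.le hbc, flip_foldSign_right hab.le (by omega)]
      have := h3 j hj hjn
      omega

/-- The other fold is disjoint from `[a, b]`. If it comes earlier, the heights after it only
increase; if later, it is translated together with its future and stays above everything up to `b`.
-/
lemma IsFold.isFold_flip (H : IsFold n h a b) {a' b' : ℕ} (H' : IsFold n h a' b')
    (hne : (a', b') ≠ (a, b)) : IsFold n (flip (foldSign a b) h) a' b' := by
  have hab := H.lt
  have hbn := H.le
  have hab' := H'.lt
  have hbn' := H'.le
  have hpos := H.height_pos
  rcases IsFold.cases (p := (a', b')) (q := (a, b)) H' H with h0 | h0 | h0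
  · exact absurd h0 hne
  · simp only at h0
    have hb' : flip (foldSign a b) h b' = h b' := flip_foldSign_left h0.le
    have ha' : flip (foldSign a b) h a' = h a' := flip_foldSign_left (by omega)
    refine ⟨hab', hbn', fun j hj => ?_, fun j hj hj' => ?_, fun j hj hj' => ?_,
      fun j hj hj' => ?_⟩
    · rw [ha', flip_foldSign_left (by omega)]; exact H'.le_left j hj
    · rw [ha', flip_foldSign_left (by omega)]; exact H'.lt_left j hj hj'
    · rw [hb']; exact (H'.right_le j hj hj').trans (H.le_flip j)
    · rw [hb']; exact (H'.right_lt j hj hj').trans_le (H.le_flip j)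
  · simp only at h0
    have hR : ∀ j, b ≤ j → flip (foldSign a b) h j = h j + 2 * (h a - h b) :=
      fun j hj => flip_foldSign_right hab.le hj
    have hlt := H.right_lt a' h0 (by omega)
    refine ⟨hab', hbn', fun j hj => ?_, fun j hj hj' => ?_, fun j hj hj' => ?_,
      fun j hj hj' => ?_⟩
    · rcases le_total j b with h5 | h5
      · refine (H.flip_le_right h5).trans ?_
        rw [hR b le_rfl, hR a' h0.le]
        omega
      · rw [hR j h5, hR a' h0.le]
        have := H'.le_left j hj
        omega
    · rw [hR j (by omega), hR a' h0.le]
      have := H'.lt_left j hj hj'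
      omega
    · rw [hR j (by omega), hR b' (by omega)]
      have := H'.right_le j hj hj'
      omega
    · rw [hR j (by omega), hR b' (by omega)]
      have := H'.right_lt j hj hj'
      omega

/-- Unfolding `[a,b]` creates at most `3 (b - a)` new renewal times. -/
lemma IsFold.card_renewals_flip_le (H : IsFold n h a b) (hp : IsProfile n h) :
    (renewals n (flip (foldSign a b) h)).card ≤ (renewals n h).card + 3 * (b - a) := by
  classical
  set g := flip (foldSign a b) h with hg
  have hab := H.lt
  have hbn := H.le
  have hpos := H.height_pos
  have hdiff : h a - h b ≤ (b - a : ℕ) := by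
    have h1 := abs_sub_le_of_step hp.step hab.le
    rw [abs_le] at h1
    omega
  -- Renewal times have distinct heights. A new one outside `[a, b)` must have had its old height in
  -- `[h b, h a)`: below this band (before `a`) or above it (after `b`) it was a renewal time
  -- already. So the two sides and `[a, b)` contribute at most `b - a` each.
  have hinj : ∀ i j, i ∈ renewals n g → j ∈ renewals n g → g i = g j → i = j := by
    intro i j hi hj e
    rw [mem_renewals] at hi hj
    rcases lt_trichotomy i j with h1 | h1 | h1
    · have := hi.2.2 j h1 hj.1.le
      omega
    · exact h1
    · have := hj.2.2 i h1 hi.1.le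
      omega
  set A := (renewals n g).filter fun i => i < a ∧ h b ≤ h i ∧ h i < h a with hA
  set B := (renewals n g).filter fun i => b ≤ i ∧ h b ≤ h i ∧ h i < h a with hB
  have hAc : A.card ≤ b - a := by
    have : A.card ≤ (Finset.Ico (h b) (h a)).card := by
      refine Finset.card_le_card_of_injOn h (fun i hi => ?_) (fun i hi j hj e => ?_)
      · simp only [hA, Finset.coe_filter, Set.mem_ofPred_eq] at hi
        simpa using hi.2.2
      · simp only [hA, Finset.coe_filter, Set.mem_ofPred_eq] at hi hj
        refine hinj i j hi.1 hj.1 ?_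
        rw [hg, flip_foldSign_left hi.2.1.le, flip_foldSign_left hj.2.1.le, e]
    rw [Int.card_Ico] at this
    omega
  have hBc : B.card ≤ b - a := by
    have : B.card ≤ (Finset.Ico (h b) (h a)).card := by
      refine Finset.card_le_card_of_injOn h (fun i hi => ?_) (fun i hi j hj e => ?_)
      · simp only [hB, Finset.coe_filter, Set.mem_ofPred_eq] at hi
        simpa using hi.2.2
      · simp only [hB, Finset.coe_filter, Set.mem_ofPred_eq] at hi hj
        refine hinj i j hi.1 hj.1 ?_
        rw [hg, flip_foldSign_right hab.le hi.2.1, flip_foldSign_right hab.le hj.2.1, e]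
    rw [Int.card_Ico] at this
    omega
  have hsub : renewals n g ⊆ renewals n h ∪ (Finset.Ico a b ∪ (A ∪ B)) := by
    intro i hi
    by_cases hih : i ∈ renewals n h
    · exact Finset.mem_union_left _ hih
    refine Finset.mem_union_right _ ?_
    have hi' := mem_renewals.1 hi
    rw [mem_renewals] at hih
    rcases lt_or_ge i a with h1 | h1
    · have hgi : g i = h i := flip_foldSign_left h1.le
      refine Finset.mem_union_right _ (Finset.mem_union_left _ ?_)
      rw [hA, Finset.mem_filter]
      have hlt : h i < h a := by
        have := hi'.2.2 a h1 (by omega)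
        rwa [hgi, hg, flip_foldSign_left le_rfl] at this
      refine ⟨hi, h1, ?_, hlt⟩
      by_contra! hc
      refine hih ⟨hi'.1, fun j hj => ?_, fun j hj hjn => ?_⟩
      · have := hi'.2.1 j hj
        rwa [hgi, hg, flip_foldSign_left (hj.trans h1.le)] at this
      · rcases le_total j a with h2 | h2
        · have := hi'.2.2 j hj hjn
          rwa [hgi, hg, flip_foldSign_left h2] at this
        · exact hc.trans_le (H.right_le j h2 hjn)
    · rcases lt_or_ge i b with h2 | h2
      · exact Finset.mem_union_left _ (Finset.mem_Ico.2 ⟨h1, h2⟩)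
      have hgi : g i = h i + 2 * (h a - h b) := flip_foldSign_right hab.le h2
      refine Finset.mem_union_right _ (Finset.mem_union_right _ ?_)
      rw [hB, Finset.mem_filter]
      refine ⟨hi, h2, H.right_le i h1 hi'.1.le, ?_⟩
      by_contra! hc
      refine hih ⟨hi'.1, fun j hj => ?_, fun j hj hjn => ?_⟩
      · rcases le_total j b with h3 | h3
        · exact (H.le_left j h3).trans hc
        · have := hi'.2.1 j hj
          rw [hgi, hg, flip_foldSign_right hab.le h3] at this
          omega
      · have := hi'.2.2 j hj hjn
        rw [hgi, hg, flip_foldSign_right hab.le (by omega)] at this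
        omega
  refine (Finset.card_le_card hsub).trans ?_
  refine (Finset.card_union_le _ _).trans ?_
  have h1 := Finset.card_union_le (Finset.Ico a b) (A ∪ B)
  have h2 := Finset.card_union_le A B
  rw [Nat.card_Ico] at h1
  omega

end Single

/-! ### Unfolding several folds -/

/-- The folds are reflected one at a time. The four properties are carried together because the next
step needs the remaining folds to have survived. -/
lemma isProfile_foldSigns {n : ℕ} {h : ℕ → ℤ} (hp : IsProfile n h) {S : Finset (ℕ × ℕ)}
    (hS : S ⊆ folds n h) :
    IsProfile n (flip (foldSigns S) h) ∧
      (∀ p ∈ folds n h, p ∉ S → p ∈ folds n (flip (foldSigns S) h)) ∧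
      (∀ p ∈ S, IsRenewal n (flip (foldSigns S) h) p.1 ∧
        IsRenewal n (flip (foldSigns S) h) p.2) ∧
      (renewals n (flip (foldSigns S) h)).card ≤
        (renewals n h).card + ∑ p ∈ S, 3 * (p.2 - p.1) := by
  classical
  induction S using Finset.induction_on with
  | empty =>
    have : flip (foldSigns ∅) h = h := by
      conv_rhs => rw [← flip_one h]
      congr 1
    simp [this, hp]
  | insert p S hpS ih =>
    obtain ⟨h1, h2, h3, h4⟩ := ih ((Finset.subset_insert _ _).trans hS)
    have H := mem_folds.1 (h2 p (hS (Finset.mem_insert_self _ _)) hpS)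
    rw [flip_insert h hpS]
    refine ⟨H.isProfile_flip h1, fun q hq hqS => ?_, fun q hq => ?_, ?_⟩
    · rw [Finset.mem_insert, not_or] at hqS
      exact mem_folds.2 (H.isFold_flip (mem_folds.1 (h2 q hq hqS.2)) hqS.1)
    · rcases Finset.mem_insert.1 hq with rfl | hq
      · exact ⟨H.isRenewal_left, H.isRenewal_right h1⟩
      · exact ⟨H.isRenewal_flip (h3 q hq).1, H.isRenewal_flip (h3 q hq).2⟩
    · rw [Finset.sum_insert hpS]
      have := H.card_renewals_flip_le h1
      omega

lemma foldSigns_eq_neg_one {n : ℕ} {h : ℕ → ℤ} {S : Finset (ℕ × ℕ)} (hS : S ⊆ folds n h)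
    {p : ℕ × ℕ} (hp : p ∈ S) {i : ℕ} (h1 : p.1 ≤ i) (h2 : i < p.2) : foldSigns S i = -1 := by
  rw [foldSigns, Finset.prod_eq_single_of_mem p hp, foldSign, if_pos ⟨h1, h2⟩]
  intro q hq hqp
  rw [foldSign, if_neg]
  rintro ⟨h3, h4⟩
  rcases (mem_folds.1 (hS hp)).cases (mem_folds.1 (hS hq)) with h | h | h
  · exact hqp h.symm
  · omega
  · omega

/-! ### Levels that are visited few times -/

/-- The number of visits of the profile `h` to the height `l` up to time `n`. -/
def visits (n : ℕ) (h : ℕ → ℤ) (l : ℤ) : ℕ :=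
  ((Finset.range (n + 1)).filter fun j => h j = l).card

/-- The heights below the top that are visited at most `k` times. -/
noncomputable def lowLevels (n k : ℕ) (h : ℕ → ℤ) : Finset ℤ :=
  (Finset.Ico 0 (h n)).filter fun l => visits n h l ≤ k

lemma mem_lowLevels {n k : ℕ} {h : ℕ → ℤ} {l : ℤ} :
    l ∈ lowLevels n k h ↔ (0 ≤ l ∧ l < h n) ∧ visits n h l ≤ k := by
  simp [lowLevels]

/-- Unfolding all folds turns each non-renewal level into one that is visited less often. -/
lemma card_lowLevels_le {n : ℕ} (k : ℕ) {h : ℕ → ℤ} (hp : IsProfile n h) :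
    (lowLevels n (k + 1) h).card ≤
      (renewals n h).card + (lowLevels n k (flip (foldSigns (folds n h)) h)).card := by
  classical
  set g := flip (foldSigns (folds n h)) h with hg
  obtain ⟨hgp, -, hgr, -⟩ := isProfile_foldSigns hp (Finset.Subset.refl (folds n h))
  rw [← hg] at hgp hgr
  set Q := (lowLevels n (k + 1) h).filter fun l => ∃ a b, IsFold n h a b ∧ h b ≤ l ∧ l < h a
    with hQ
  have hsub : lowLevels n (k + 1) h ⊆ (renewals n h).image h ∪ Q := by
    intro l hl
    have hl' := mem_lowLevels.1 hl
    rcases exists_renewal_or_fold hp hl'.1.1 hl'.1.2 with ⟨i, hi, e⟩ | hf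
    · exact Finset.mem_union_left _ (Finset.mem_image.2 ⟨i, mem_renewals.2 hi, e⟩)
    · exact Finset.mem_union_right _ (Finset.mem_filter.2 ⟨hl, hf⟩)
  have hch : ∀ l : ℤ, ∃ p : ℕ × ℕ, l ∈ Q → IsFold n h p.1 p.2 ∧ h p.2 ≤ l ∧ l < h p.1 := by
    intro l
    by_cases hl : l ∈ Q
    · obtain ⟨a, b, hab⟩ := (Finset.mem_filter.1 hl).2
      exact ⟨(a, b), fun _ => hab⟩
    · exact ⟨(0, 0), fun h => absurd h hl⟩
  choose P hP using hch
  have hmid : ∀ l ∈ Q, ∀ j, (P l).1 ≤ j → j ≤ (P l).2 → g j = g (P l).1 + h (P l).1 - h j := by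
    intro l hl j h1 h2
    exact flip_const_neg (fun i h3 h4 => foldSigns_eq_neg_one (Finset.Subset.refl _)
      (mem_folds.2 (hP l hl).1) h3 h4) h1 h2
  have hQc : Q.card ≤ (lowLevels n k g).card := by
    -- A level goes to its mirror image in the unfolded fold. Images from one fold `(a, b)` lie in
    -- `(g a, g b]`, and these ranges are disjoint for distinct folds since the endpoints are now
    -- renewal times.
    refine Finset.card_le_card_of_injOn (fun l => g (P l).1 + h (P l).1 - l) ?_ ?_
    · intro l hl
      have hl : l ∈ Q := hl
      obtain ⟨H, hb, ha⟩ := hP l hl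
      obtain ⟨hra, hrb⟩ := hgr (P l) (mem_folds.2 H)
      have hlow := mem_lowLevels.1 (Finset.mem_filter.1 hl).1
      have hgb := hmid l hl (P l).2 H.lt.le le_rfl
      have hga0 : 0 ≤ g (P l).1 := by
        have := hra.2.1 0 (Nat.zero_le _)
        rwa [hgp.zero] at this
      have hbn := hrb.2.2 n (H.lt_length hp) le_rfl
      refine Finset.mem_coe.2 (mem_lowLevels.2 ⟨⟨?_, ?_⟩, ?_⟩)
      · dsimp only; omega
      · dsimp only; omega
      -- The old profile already crossed `l` on its way up to the left end of the fold. The new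
      -- level is only reached inside the fold, so this visit `i` is lost and the count drops
      -- strictly.
      · obtain ⟨i, hi, hil⟩ := exists_eq_of_step hp.step (l := l) (c := (P l).1)
          (by rw [hp.zero]; exact hlow.1.1) ha.le
        have hlt : visits n g (g (P l).1 + h (P l).1 - l) < visits n h l := by
          refine Finset.card_lt_card ?_
          rw [Finset.ssubset_iff_of_subset]
          · refine ⟨i, ?_, ?_⟩
            · simp only [Finset.mem_filter, Finset.mem_range]
              have := H.lt
              have := H.le
              exact ⟨by omega, hil⟩
            · simp only [Finset.mem_filter, not_and]
              intro _ h5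
              have := hra.2.1 i hi
              omega
          · intro j hj
            simp only [Finset.mem_filter, Finset.mem_range] at hj ⊢
            refine ⟨hj.1, ?_⟩
            have hj1 : (P l).1 ≤ j := by
              by_contra! hc
              have := hra.2.1 j hc.le
              omega
            have hj2 : j ≤ (P l).2 := by
              by_contra! hc
              have := hrb.2.2 j hc (by omega)
              omega
            have := hmid l hl j hj1 hj2
            omega
        have := hlow.2
        dsimp only
        omega
    · intro l hl l' hl' e
      have hl : l ∈ Q := hl
      have hl' : l' ∈ Q := hl'
      dsimp only at e
      obtain ⟨H, hb, ha⟩ := hP l hl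
      obtain ⟨H', hb', ha'⟩ := hP l' hl'
      have hgb := hmid l hl (P l).2 H.lt.le le_rfl
      have hgb' := hmid l' hl' (P l').2 H'.lt.le le_rfl
      rcases H.cases H' with h0 | h0 | h0
      · rw [h0] at e
        omega
      · have := (hgr (P l') (mem_folds.2 H')).1.2.1 _ h0.le
        omega
      · have := (hgr (P l) (mem_folds.2 H)).1.2.1 _ h0.le
        omega
  calc (lowLevels n (k + 1) h).card ≤ ((renewals n h).image h ∪ Q).card :=
        Finset.card_le_card hsub
    _ ≤ ((renewals n h).image h).card + Q.card := Finset.card_union_le _ _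
    _ ≤ _ := Nat.add_le_add Finset.card_image_le hQc

lemma lowLevels_zero {n : ℕ} {h : ℕ → ℤ} (hp : IsProfile n h) : lowLevels n 0 h = ∅ := by
  rw [Finset.eq_empty_iff_forall_notMem]
  intro l hl
  obtain ⟨⟨h1, h2⟩, h3⟩ := mem_lowLevels.1 hl
  obtain ⟨i, hi, e⟩ := exists_eq_of_step hp.step (l := l) (c := n) (by rw [hp.zero]; exact h1) h2.le
  rw [visits, Nat.le_zero, Finset.card_eq_zero] at h3
  have : i ∈ (Finset.range (n + 1)).filter fun j => h j = l := by
    simp only [Finset.mem_filter, Finset.mem_range]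
    exact ⟨by omega, e⟩
  rw [h3] at this
  simp at this

/-- Each level outside `lowLevels` uses up at least `k + 1` of the `n + 1` times. -/
lemma height_le_card_lowLevels {n : ℕ} (k : ℕ) (h : ℕ → ℤ) :
    (k + 1) * (h n).toNat ≤ (k + 1) * (lowLevels n k h).card + (n + 1) := by
  classical
  have h1 := Finset.card_filter_add_card_filter_not (s := Finset.Ico 0 (h n))
    (fun l => visits n h l ≤ k)
  rw [Int.card_Ico, sub_zero] at h1
  have h2 : ((Finset.Ico 0 (h n)).filter fun l => ¬ visits n h l ≤ k).card * (k + 1) ≤ n + 1 := by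
    rw [← smul_eq_mul]
    calc _ ≤ ∑ l ∈ (Finset.Ico 0 (h n)).filter fun l => ¬ visits n h l ≤ k, visits n h l := by
          refine Finset.card_nsmul_le_sum _ _ _ fun l hl => ?_
          have := (Finset.mem_filter.1 hl).2
          omega
      _ ≤ (Finset.range (n + 1)).card := by
          unfold visits
          rw [← Finset.card_biUnion]
          · exact Finset.card_le_card (Finset.biUnion_subset.2 fun l _ => Finset.filter_subset _ _)
          · intro l _ l' _ hll
            rw [Function.onFun, Finset.disjoint_filter]
            intro j _ e e'
            exact hll (e.symm.trans e')
      _ = n + 1 := Finset.card_range _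
  rw [← h1, lowLevels]
  linarith

lemma sum_length_folds_le (n : ℕ) (h : ℕ → ℤ) : ∑ p ∈ folds n h, (p.2 - p.1) ≤ n := by
  classical
  calc ∑ p ∈ folds n h, (p.2 - p.1) = ∑ p ∈ folds n h, (Finset.Ico p.1 p.2).card := by simp
    _ = ((folds n h).biUnion fun p => Finset.Ico p.1 p.2).card := by
        rw [Finset.card_biUnion]
        intro p hp q hq hpq
        rw [Function.onFun, Finset.disjoint_left]
        intro i hi hi'
        rw [Finset.mem_Ico] at hi hi'
        rcases (mem_folds.1 hp).cases (mem_folds.1 hq) with h | h | h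
        · exact hpq h
        · omega
        · omega
    _ ≤ (Finset.range n).card := by
        refine Finset.card_le_card (Finset.biUnion_subset.2 fun p hp i hi => ?_)
        rw [Finset.mem_Ico] at hi
        have := (mem_folds.1 hp).le
        rw [Finset.mem_range]
        omega
    _ = n := Finset.card_range n

/-- The signs of a family of folds depend only on the sets of left and right endpoints. -/
lemma foldSigns_eq_prod {n : ℕ} {h : ℕ → ℤ} {S : Finset (ℕ × ℕ)} (hS : S ⊆ folds n h) (i : ℕ) :
    foldSigns S i = (∏ a ∈ S.image Prod.fst, if a ≤ i then (-1 : ℤ) else 1) *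
      ∏ b ∈ S.image Prod.snd, if b ≤ i then (-1 : ℤ) else 1 := by
  have hcases : ∀ p ∈ S, ∀ q ∈ S, p = q ∨ p.2 < q.1 ∨ q.2 < p.1 := fun p hp q hq =>
    (mem_folds.1 (hS hp)).cases (mem_folds.1 (hS hq))
  have hlt : ∀ p ∈ S, p.1 < p.2 := fun p hp => (mem_folds.1 (hS hp)).lt
  rw [Finset.prod_image, Finset.prod_image, ← Finset.prod_mul_distrib, foldSigns]
  · refine Finset.prod_congr rfl fun p hp => ?_
    have := hlt p hp
    unfold foldSign
    split_ifs <;> first | rfl | omega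
  · intro p hp q hq e
    have := hlt p hp
    have := hlt q hq
    rcases hcases p hp q hq with h | h | h
    · exact h
    · omega
    · omega
  · intro p hp q hq e
    have := hlt p hp
    have := hlt q hq
    rcases hcases p hp q hq with h | h | h
    · exact h
    · omega
    · omega

lemma eq_of_image_fst_eq {n : ℕ} {h : ℕ → ℤ} {S T : Finset (ℕ × ℕ)} (hS : S ⊆ folds n h)
    (hT : T ⊆ folds n h) (e : S.image Prod.fst = T.image Prod.fst) : S = T := by
  have key : ∀ S T : Finset (ℕ × ℕ), S ⊆ folds n h → T ⊆ folds n h →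
      S.image Prod.fst = T.image Prod.fst → S ⊆ T := by
    intro S T hS hT e p hp
    have : p.1 ∈ T.image Prod.fst := e ▸ Finset.mem_image_of_mem _ hp
    obtain ⟨q, hq, hqp⟩ := Finset.mem_image.1 this
    have Hp := mem_folds.1 (hS hp)
    have Hq := mem_folds.1 (hT hq)
    have := Hp.lt
    have := Hq.lt
    rcases Hp.cases Hq with h | h | h
    · rwa [h]
    · omega
    · omega
  exact Finset.Subset.antisymm (key S T hS hT e) (key T S hT hS e.symm)

/-! ### Walks and bridges indexed by the natural numbers -/

variable {d : ℕ}

/-- A self-avoiding walk of length `n` from the origin, kept constant after time `n`. -/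
structure IsWalk (d n : ℕ) (w : ℕ → Fin d → ℤ) : Prop where
  zero : w 0 = 0
  bond : ∀ i < n, IsBond (w i) (w (i + 1))
  inj : ∀ i j, i < j → j ≤ n → w i ≠ w j
  frozen : ∀ i, n ≤ i → w i = w n

/-- The heights of a walk. -/
def profile (hd : 2 ≤ d) (w : ℕ → Fin d → ℤ) (i : ℕ) : ℤ := y hd (w i)

/-- A bridge of length `n` from the origin, kept constant after time `n`. -/
structure IsBridge (hd : 2 ≤ d) (n : ℕ) (w : ℕ → Fin d → ℤ) : Prop where
  walk : IsWalk d n w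
  pos : ∀ j, 0 < j → j ≤ n → 0 < profile hd w j
  le_last : ∀ j ≤ n, profile hd w j ≤ profile hd w n

lemma IsBond.abs_sub_le {u v : Fin d → ℤ} (huv : IsBond u v) (i : Fin d) :
    |v i - u i| ≤ 1 := by
  rw [abs_sub_comm]
  exact (Finset.single_le_sum (f := fun i => |u i - v i|) (fun i _ => abs_nonneg _)
    (Finset.mem_univ i)).trans_eq huv

lemma IsBridge.isProfile {hd : 2 ≤ d} {n : ℕ} {w : ℕ → Fin d → ℤ} (hw : IsBridge hd n w) :
    IsProfile n (profile hd w) where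
  step i := by
    rcases lt_or_ge i n with h | h
    · exact (hw.walk.bond i h).abs_sub_le _
    · rw [profile, profile, hw.walk.frozen i h, hw.walk.frozen (i + 1) (by omega)]
      simp
  zero := by simp [profile, hw.walk.zero, y]
  pos := hw.pos
  le_last := hw.le_last

lemma IsWalk.abs_le {n : ℕ} {w : ℕ → Fin d → ℤ} (hw : IsWalk d n w) {i : ℕ} (hi : i ≤ n)
    (j : Fin d) : |w i j| ≤ i := by
  induction i with
  | zero => simp [hw.zero]
  | succ i ih =>
    have h1 := ih (by omega)
    have h2 := (hw.bond i (by omega)).abs_sub_le j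
    rw [_root_.abs_le] at *
    push_cast
    omega

lemma IsWalk.ext {n : ℕ} {w w' : ℕ → Fin d → ℤ} (hw : IsWalk d n w) (hw' : IsWalk d n w')
    (h : ∀ i ≤ n, w i = w' i) : w = w' := by
  funext i
  rcases le_total i n with hi | hi
  · exact h i hi
  · rw [hw.frozen i hi, hw'.frozen i hi, h n le_rfl]

lemma finite_isWalk (d n : ℕ) : {w | IsWalk d n w}.Finite := by
  refine Set.Finite.of_finite_image (f := fun w (i : Fin (n + 1)) => w i)
    (Set.Finite.subset (Set.Finite.pi' (t := fun _ : Fin (n + 1) => {u : Fin d → ℤ |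
      ∀ j, u j ∈ Set.Icc (-n : ℤ) n})
      fun _ => Set.Finite.pi' fun _ => Set.finite_Icc _ _) ?_) ?_
  · rintro _ ⟨w, hw, rfl⟩ i j
    have h1 := IsWalk.abs_le hw (Nat.lt_succ_iff.1 i.2) j
    have h2 := Nat.lt_succ_iff.1 i.2
    rw [_root_.abs_le] at h1
    constructor <;> dsimp only <;> omega
  · intro w hw w' hw' e
    exact IsWalk.ext hw hw' fun i hi => congrFun e ⟨i, Nat.lt_succ_iff.2 hi⟩

/-- The self-avoiding walks of length `n`. -/
noncomputable def walks (d n : ℕ) : Finset (ℕ → Fin d → ℤ) := (finite_isWalk d n).toFinset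

lemma mem_walks {n : ℕ} {w : ℕ → Fin d → ℤ} : w ∈ walks d n ↔ IsWalk d n w := by
  simp [walks]

open Classical in
/-- The bridges of length `n`. -/
noncomputable def bridges (hd : 2 ≤ d) (n : ℕ) : Finset (ℕ → Fin d → ℤ) :=
  (walks d n).filter (IsBridge hd n)

lemma mem_bridges {hd : 2 ≤ d} {n : ℕ} {w : ℕ → Fin d → ℤ} :
    w ∈ bridges hd n ↔ IsBridge hd n w := by
  simp only [bridges, Finset.mem_filter, mem_walks, and_iff_right_iff_imp]
  exact fun h => h.walk

/-! ### Unfolding walks -/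

/-- Replace the height profile of `w` by the flipped one. -/
def unfold (hd : 2 ≤ d) (σ : ℕ → ℤ) (w : ℕ → Fin d → ℤ) (i : ℕ) : Fin d → ℤ :=
  Function.update (w i) ⟨1, hd⟩ (flip σ (profile hd w) i)

lemma profile_unfold (hd : 2 ≤ d) (σ : ℕ → ℤ) (w : ℕ → Fin d → ℤ) :
    profile hd (unfold hd σ w) = flip σ (profile hd w) := by
  funext i
  simp [profile, unfold, y]

lemma unfold_unfold (hd : 2 ≤ d) (σ τ : ℕ → ℤ) (w : ℕ → Fin d → ℤ) :
    unfold hd τ (unfold hd σ w) = unfold hd (fun i => τ i * σ i) w := by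
  funext i
  conv_lhs => rw [unfold, profile_unfold, flip_flip]
  simp [unfold]

lemma unfold_one (hd : 2 ≤ d) (w : ℕ → Fin d → ℤ) : unfold hd (fun _ => 1) w = w := by
  funext i
  rw [unfold, flip_one]
  exact Function.update_eq_self _ _

lemma unfold_apply_of_ne (hd : 2 ≤ d) (σ : ℕ → ℤ) (w : ℕ → Fin d → ℤ) (i : ℕ) {k : Fin d}
    (hk : k ≠ ⟨1, hd⟩) : unfold hd σ w i k = w i k := by
  simp [unfold, hk]

/-- After unfolding, `a` and `b` are renewal times, so the three pieces occupy disjoint ranges of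
heights. A self-intersection would therefore stay within one piece, which is only a translate or a
reflection of the original. -/
lemma IsBridge.unfold_foldSign {hd : 2 ≤ d} {n : ℕ} {w : ℕ → Fin d → ℤ} (hw : IsBridge hd n w)
    {a b : ℕ} (H : IsFold n (profile hd w) a b) : IsBridge hd n (unfold hd (foldSign a b) w) := by
  have hp := hw.isProfile
  have hp' := H.isProfile_flip hp
  have hra := H.isRenewal_left
  have hrb := H.isRenewal_right hp
  rw [← profile_unfold hd] at hp' hra hrb
  have hab := H.lt
  have hbn := H.le
  refine ⟨⟨?_, fun i hi => ?_, fun i j hij hjn e => ?_, fun i hi => ?_⟩, hp'.pos, hp'.le_last⟩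
  · rw [unfold, flip_zero, hw.walk.zero, hp.zero]
    simp
  · rw [IsBond, ← hw.walk.bond i hi]
    refine Finset.sum_congr rfl fun k _ => ?_
    by_cases hk : k = ⟨1, hd⟩
    · subst hk
      rw [abs_sub_comm, abs_sub_comm (w i _)]
      simp only [unfold, Function.update_self]
      rw [flip_succ, add_sub_cancel_left, abs_mul]
      rcases foldSign_cases a b i with h1 | h1 <;> rw [h1] <;> simp [profile, y]
    · rw [unfold_apply_of_ne hd _ _ _ hk, unfold_apply_of_ne hd _ _ _ hk]
  · refine hw.walk.inj i j hij hjn (funext fun k => ?_)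
    by_cases hk : k = ⟨1, hd⟩
    · subst hk
      change profile hd w i = profile hd w j
      have e' : profile hd (unfold hd (foldSign a b) w) i =
        profile hd (unfold hd (foldSign a b) w) j := by rw [profile, profile, e]
      have h1 : i ≤ a → j ≤ a := fun h => by
        by_contra! hc
        have := hra.2.1 i h
        have := hra.2.2 j hc hjn
        omega
      have h2 : i ≤ b → j ≤ b := fun h => by
        by_contra! hc
        have := hrb.2.1 i h
        have := hrb.2.2 j hc hjn
        omega
      rw [profile_unfold] at e'
      rcases le_or_gt i a with hia | hia
      · rwa [flip_foldSign_left hia, flip_foldSign_left (h1 hia)] at e'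
      rcases le_or_gt i b with hib | hib
      · rw [flip_foldSign_mid hia.le hib, flip_foldSign_mid (hia.trans hij).le (h2 hib)] at e'
        omega
      · rw [flip_foldSign_right hab.le hib.le, flip_foldSign_right hab.le (hib.trans hij).le] at e'
        omega
    · have := congrFun e k
      rwa [unfold_apply_of_ne hd _ _ _ hk, unfold_apply_of_ne hd _ _ _ hk] at this
  · have hbn := H.lt_length hp
    rw [unfold, unfold, flip_foldSign_right hab.le (by omega), flip_foldSign_right hab.le H.le,
      profile, profile, hw.walk.frozen i hi]
    rfl

lemma IsBridge.unfold_foldSigns {hd : 2 ≤ d} {n : ℕ} {w : ℕ → Fin d → ℤ} (hw : IsBridge hd n w)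
    {S : Finset (ℕ × ℕ)} (hS : S ⊆ folds n (profile hd w)) :
    IsBridge hd n (unfold hd (foldSigns S) w) := by
  classical
  induction S using Finset.induction_on with
  | empty =>
    have : unfold hd (foldSigns ∅) w = w := by
      conv_rhs => rw [← unfold_one hd w]
      congr 1
    rwa [this]
  | insert p S hpS ih =>
    have hS' := (Finset.subset_insert _ _).trans hS
    have h1 := ih hS'
    have h2 := (isProfile_foldSigns hw.isProfile hS').2.1 p (hS (Finset.mem_insert_self _ _)) hpS
    rw [← profile_unfold hd, mem_folds] at h2
    have h3 := h1.unfold_foldSign h2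
    rw [unfold_unfold] at h3
    convert h3 using 2
    funext i
    rw [foldSigns, Finset.prod_insert hpS, foldSigns]

/-- The unfolded walk and the sets of endpoints of the folds determine the walk and the folds. -/
lemma unfold_injective {hd : 2 ≤ d} {n : ℕ} {w w' : ℕ → Fin d → ℤ} {S S' : Finset (ℕ × ℕ)}
    (hS : S ⊆ folds n (profile hd w)) (hS' : S' ⊆ folds n (profile hd w'))
    (e : unfold hd (foldSigns S) w = unfold hd (foldSigns S') w')
    (e1 : S.image Prod.fst = S'.image Prod.fst) (e2 : S.image Prod.snd = S'.image Prod.snd) :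
    w = w' ∧ S = S' := by
  have hσ : foldSigns S = foldSigns S' := by
    funext i
    rw [foldSigns_eq_prod hS, foldSigns_eq_prod hS', e1, e2]
  have hw : w = w' := by
    have h1 := congrArg (unfold hd (foldSigns S)) e
    rw [← hσ, unfold_unfold, unfold_unfold] at h1
    simp_rw [foldSigns_mul_self] at h1
    rwa [unfold_one, unfold_one] at h1
  subst hw
  exact ⟨rfl, eq_of_image_fst_eq hS hS' e1⟩

/-! ### Cutting and concatenating walks -/

/-- The first `m` steps of a walk. -/
def take (m : ℕ) (w : ℕ → Fin d → ℤ) (i : ℕ) : Fin d → ℤ := w (min i m)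

/-- The walk after time `m`, translated to start at the origin. -/
def drop (m : ℕ) (w : ℕ → Fin d → ℤ) (i : ℕ) : Fin d → ℤ := w (m + i) - w m

/-- The concatenation of the first `m` steps of `u` with `v`. -/
def concat (m : ℕ) (u v : ℕ → Fin d → ℤ) (i : ℕ) : Fin d → ℤ :=
  if i ≤ m then u i else u m + v (i - m)

lemma take_apply {m i : ℕ} (w : ℕ → Fin d → ℤ) (hi : i ≤ m) : take m w i = w i := by
  rw [take, min_eq_left hi]

lemma concat_left {m i : ℕ} (u v : ℕ → Fin d → ℤ) (hi : i ≤ m) : concat m u v i = u i := by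
  rw [concat, if_pos hi]

lemma concat_right {m : ℕ} (u : ℕ → Fin d → ℤ) {v : ℕ → Fin d → ℤ} (hv : v 0 = 0) (i : ℕ) :
    concat m u v (m + i) = u m + v i := by
  rcases Nat.eq_zero_or_pos i with rfl | hi
  · simp [concat, hv]
  · rw [concat, if_neg (by omega), Nat.add_sub_cancel_left]

lemma profile_take {hd : 2 ≤ d} {m i : ℕ} (w : ℕ → Fin d → ℤ) (hi : i ≤ m) :
    profile hd (take m w) i = profile hd w i := by
  rw [profile, take_apply w hi, profile]

lemma profile_drop {hd : 2 ≤ d} {m : ℕ} (w : ℕ → Fin d → ℤ) (i : ℕ) :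
    profile hd (drop m w) i = profile hd w (m + i) - profile hd w m := by
  simp [profile, drop, y]

lemma isBond_add {u v x : Fin d → ℤ} : IsBond (x + u) (x + v) ↔ IsBond u v := by
  simp [IsBond]

lemma isBond_sub {u v x : Fin d → ℤ} : IsBond (u - x) (v - x) ↔ IsBond u v := by
  simp [IsBond]

lemma IsWalk.take {m n : ℕ} {w : ℕ → Fin d → ℤ} (hw : IsWalk d n w) (hmn : m ≤ n) :
    IsWalk d m (take m w) where
  zero := by rw [take_apply w (Nat.zero_le m), hw.zero]
  bond i hi := by
    rw [take_apply w hi.le, take_apply w hi]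
    exact hw.bond i (by omega)
  inj i j hij hj := by
    rw [take_apply w (hij.le.trans hj), take_apply w hj]
    exact hw.inj i j hij (hj.trans hmn)
  frozen i hi := by simp [SelfAvoiding.take, hi]

lemma IsWalk.drop {m n : ℕ} {w : ℕ → Fin d → ℤ} (hw : IsWalk d (m + n) w) :
    IsWalk d n (drop m w) where
  zero := by simp [SelfAvoiding.drop]
  bond i hi := isBond_sub.2 (hw.bond (m + i) (by omega))
  inj i j hij hj e := hw.inj (m + i) (m + j) (by omega) (by omega) (sub_left_injective e)
  frozen i hi := by
    rw [SelfAvoiding.drop, SelfAvoiding.drop, hw.frozen (m + i) (by omega)]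

lemma concat_take_drop (m : ℕ) (w : ℕ → Fin d → ℤ) : concat m (take m w) (drop m w) = w := by
  funext i
  rw [concat]
  split_ifs with hi
  · exact take_apply w hi
  · rw [take_apply w le_rfl, drop, Nat.add_sub_cancel' (by omega)]
    abel

lemma take_concat {m : ℕ} {u : ℕ → Fin d → ℤ} (hu : IsWalk d m u) (v : ℕ → Fin d → ℤ) :
    take m (concat m u v) = u := by
  funext i
  rw [take, concat_left _ _ (min_le_right i m)]
  rcases le_total i m with h | h
  · rw [min_eq_left h]
  · rw [min_eq_right h, hu.frozen i h]

lemma drop_concat (m : ℕ) (u : ℕ → Fin d → ℤ) {v : ℕ → Fin d → ℤ} (hv : v 0 = 0) :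
    drop m (concat m u v) = v := by
  funext i
  rw [drop, concat_right u hv, concat_left _ _ le_rfl, add_sub_cancel_left]

/-- The time `m ≤ n` splits the profile `h` into two profiles of bridges. -/
def IsCut (n : ℕ) (h : ℕ → ℤ) (m : ℕ) : Prop :=
  m ≤ n ∧ (∀ j ≤ m, h j ≤ h m) ∧ ∀ j, m < j → j ≤ n → h m < h j

lemma IsBridge.take {hd : 2 ≤ d} {m n : ℕ} {w : ℕ → Fin d → ℤ} (hw : IsBridge hd n w)
    (hm : IsCut n (profile hd w) m) : IsBridge hd m (take m w) where
  walk := hw.walk.take hm.1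
  pos j hj hjm := by
    rw [profile_take w hjm]
    exact hw.pos j hj (hjm.trans hm.1)
  le_last j hjm := by
    rw [profile_take w hjm, profile_take w le_rfl]
    exact hm.2.1 j hjm

lemma IsBridge.drop {hd : 2 ≤ d} {m n : ℕ} {w : ℕ → Fin d → ℤ} (hw : IsBridge hd (m + n) w)
    (hm : IsCut (m + n) (profile hd w) m) : IsBridge hd n (drop m w) where
  walk := hw.walk.drop
  pos j hj hjm := by
    rw [profile_drop]
    have := hm.2.2 (m + j) (by omega) (by omega)
    omega
  le_last j hjm := by
    rw [profile_drop, profile_drop]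
    have := hw.le_last (m + j) (by omega)
    omega

lemma profile_concat_left {hd : 2 ≤ d} {m : ℕ} (u v : ℕ → Fin d → ℤ) {i : ℕ} (hi : i ≤ m) :
    profile hd (concat m u v) i = profile hd u i := by
  rw [profile, concat_left _ _ hi, profile]

lemma profile_concat_right {hd : 2 ≤ d} {m : ℕ} (u : ℕ → Fin d → ℤ) {v : ℕ → Fin d → ℤ}
    (hv : v 0 = 0) (i : ℕ) :
    profile hd (concat m u v) (m + i) = profile hd u m + profile hd v i := by
  rw [profile, concat_right _ hv]
  simp [profile, y]

lemma isCut_concat {hd : 2 ≤ d} {m n : ℕ} {u v : ℕ → Fin d → ℤ} (hu : IsBridge hd m u)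
    (hv : IsBridge hd n v) : IsCut (m + n) (profile hd (concat m u v)) m := by
  refine ⟨by omega, fun j hj => ?_, fun j hj hjn => ?_⟩
  · rw [profile_concat_left _ _ hj, profile_concat_left _ _ le_rfl]
    exact hu.le_last j hj
  · obtain ⟨i, rfl⟩ := Nat.exists_eq_add_of_le hj.le
    rw [profile_concat_left _ _ le_rfl, profile_concat_right u hv.walk.zero]
    have := hv.pos i (by omega) (by omega)
    omega

lemma IsBridge.concat {hd : 2 ≤ d} {m n : ℕ} {u v : ℕ → Fin d → ℤ} (hu : IsBridge hd m u)
    (hv : IsBridge hd n v) : IsBridge hd (m + n) (concat m u v) := by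
  have hcut := isCut_concat hu hv
  have hv0 := hv.walk.zero
  have hpu := hu.isProfile
  have hpv := hv.isProfile
  have hum : 0 ≤ profile hd u m := by
    have := hu.le_last 0 (Nat.zero_le m)
    rwa [hpu.zero] at this
  refine ⟨⟨?_, fun i hi => ?_, fun i j hij hjn e => ?_, fun i hi => ?_⟩, fun j hj hjn => ?_,
    fun j hjn => ?_⟩
  · rw [concat_left _ _ (Nat.zero_le m), hu.walk.zero]
  · rcases lt_or_ge i m with h | h
    · rw [concat_left _ _ h.le, concat_left _ _ (by omega)]
      exact hu.walk.bond i h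
    · obtain ⟨k, rfl⟩ := Nat.exists_eq_add_of_le h
      rw [add_assoc, concat_right u hv0, concat_right u hv0, isBond_add]
      exact hv.walk.bond k (by omega)
  · rcases le_or_gt j m with hj | hj
    · rw [concat_left _ _ (by omega), concat_left _ _ hj] at e
      exact hu.walk.inj i j hij hj e
    rcases le_or_gt i m with hi | hi
    · have h1 := hcut.2.1 i hi
      have h2 := hcut.2.2 j hj hjn
      rw [profile, e] at h1
      rw [profile, profile] at h2
      rw [profile] at h1
      omega
    · obtain ⟨k, rfl⟩ := Nat.exists_eq_add_of_le hi.le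
      obtain ⟨l, rfl⟩ := Nat.exists_eq_add_of_le hj.le
      rw [concat_right u hv0, concat_right u hv0] at e
      exact hv.walk.inj k l (by omega) (by omega) (add_left_cancel e)
  · obtain ⟨k, rfl⟩ := Nat.exists_eq_add_of_le (show m ≤ i by omega)
    rw [concat_right u hv0, concat_right u hv0, hv.walk.frozen k (by omega)]
  · rcases le_or_gt j m with hjm | hjm
    · rw [profile_concat_left _ _ hjm]
      exact hu.pos j hj hjm
    · have := hcut.2.2 j hjm hjn
      rw [profile_concat_left _ _ le_rfl] at this
      omega
  · rw [profile_concat_right u hv0]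
    rcases le_or_gt j m with hjm | hjm
    · rw [profile_concat_left _ _ hjm]
      have h1 := hu.le_last j hjm
      have h2 := hv.le_last 0 (Nat.zero_le n)
      rw [hpv.zero] at h2
      omega
    · obtain ⟨k, rfl⟩ := Nat.exists_eq_add_of_le hjm.le
      rw [profile_concat_right u hv0]
      have := hv.le_last k (by omega)
      omega

/-- Renewal times are additive at a cut. -/
lemma card_renewals_cut {hd : 2 ≤ d} {m n : ℕ} {w : ℕ → Fin d → ℤ}
    (hm : IsCut (m + n) (profile hd w) m) :
    (renewals (m + n) (profile hd w)).card = (renewals m (profile hd (take m w))).card +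
      (renewals n (profile hd (drop m w))).card := by
  classical
  have h1 : renewals (m + n) (profile hd w) = renewals m (profile hd (take m w)) ∪
      (renewals n (profile hd (drop m w))).image (m + ·) := by
    ext i
    simp only [Finset.mem_union, Finset.mem_image, mem_renewals]
    constructor
    · rintro ⟨h1, h2, h3⟩
      rcases lt_or_ge i m with h | h
      · left
        refine ⟨h, fun j hj => ?_, fun j hj hjm => ?_⟩
        · rw [profile_take w (by omega), profile_take w h.le]
          exact h2 j hj
        · rw [profile_take w hjm, profile_take w h.le]
          exact h3 j hj (by omega)
      · right
        obtain ⟨k, rfl⟩ := Nat.exists_eq_add_of_le h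
        refine ⟨k, ⟨by omega, fun j hj => ?_, fun j hj hjm => ?_⟩, rfl⟩
        · rw [profile_drop, profile_drop]
          have := h2 (m + j) (by omega)
          omega
        · rw [profile_drop, profile_drop]
          have := h3 (m + j) (by omega) (by omega)
          omega
    · rintro (⟨h1, h2, h3⟩ | ⟨k, ⟨h1, h2, h3⟩, rfl⟩)
      · have h4 := h3 m h1 le_rfl
        rw [profile_take w h1.le, profile_take w le_rfl] at h4
        refine ⟨by omega, fun j hj => ?_, fun j hj hjm => ?_⟩
        · have := h2 j hj
          rwa [profile_take w (by omega), profile_take w h1.le] at this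
        · rcases le_or_gt j m with hjm' | hjm'
          · have := h3 j hj hjm'
            rwa [profile_take w hjm', profile_take w h1.le] at this
          · exact h4.trans (hm.2.2 j hjm' hjm)
      · refine ⟨by omega, fun j hj => ?_, fun j hj hjm => ?_⟩
        · rcases le_or_gt j m with hjm' | hjm'
          · have h4 := hm.2.1 j hjm'
            have h5 := h2 0 (Nat.zero_le k)
            rw [profile_drop, profile_drop, add_zero] at h5
            omega
          · obtain ⟨l, rfl⟩ := Nat.exists_eq_add_of_le hjm'.le
            have := h2 l (by omega)
            rw [profile_drop, profile_drop] at this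
            omega
        · obtain ⟨l, rfl⟩ := Nat.exists_eq_add_of_le (show m ≤ j by omega)
          have := h3 l (by omega) (by omega)
          rw [profile_drop, profile_drop] at this
          omega
  rw [h1, Finset.card_union_of_disjoint, Finset.card_image_of_injective _ (add_right_injective m)]
  rw [Finset.disjoint_left]
  intro i hi hi'
  obtain ⟨k, -, rfl⟩ := Finset.mem_image.1 hi'
  have := (mem_renewals.1 hi).1
  omega

/-! ### Irreducible bridges and the renewal decomposition -/

lemma IsProfile.isRenewal_zero {n : ℕ} {h : ℕ → ℤ} (hp : IsProfile n h) (hn : 0 < n) :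
    IsRenewal n h 0 := by
  refine ⟨hn, fun j hj => by rw [Nat.le_zero.1 hj], fun j hj hjn => ?_⟩
  rw [hp.zero]
  exact hp.pos j hj hjn

/-- Time `0` counts as a renewal time and time `n` does not, so the number of renewal times is the
number of irreducible pieces. -/
lemma card_renewals_eq_one_iff {n : ℕ} {h : ℕ → ℤ} (hp : IsProfile n h) :
    (renewals n h).card = 1 ↔ 0 < n ∧ ∀ k, 0 < k → ¬ IsRenewal n h k := by
  constructor
  · intro h1
    have hn : 0 < n := by
      rcases Nat.eq_zero_or_pos n with rfl | hn
      · simp [renewals] at h1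
      · exact hn
    refine ⟨hn, fun k hk hr => ?_⟩
    have := Finset.card_le_one.1 h1.le 0 (mem_renewals.2 (hp.isRenewal_zero hn)) k
      (mem_renewals.2 hr)
    omega
  · rintro ⟨hn, hk⟩
    rw [Finset.card_eq_one]
    refine ⟨0, Finset.eq_singleton_iff_unique_mem.2 ⟨mem_renewals.2 (hp.isRenewal_zero hn),
      fun k hr => ?_⟩⟩
    by_contra hk0
    exact hk k (Nat.pos_of_ne_zero hk0) (mem_renewals.1 hr)

/-- The irreducible bridges of length `n`. -/
noncomputable def irreducibles (hd : 2 ≤ d) (n : ℕ) : Finset (ℕ → Fin d → ℤ) :=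
  (bridges hd n).filter fun w => (renewals n (profile hd w)).card = 1

/-- Every bridge of positive length starts with an irreducible bridge. -/
lemma IsBridge.exists_cut {hd : 2 ≤ d} {n : ℕ} {w : ℕ → Fin d → ℤ} (hw : IsBridge hd n w)
    (hn : 0 < n) : ∃ m, 0 < m ∧ IsCut n (profile hd w) m ∧
      SelfAvoiding.take m w ∈ irreducibles hd m := by
  classical
  -- A cut, unlike a renewal time, may be `n` itself, so a smallest positive one exists. A positive
  -- renewal time of the piece before it would be a smaller cut.
  have hex : ∃ m, 0 < m ∧ IsCut n (profile hd w) m :=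
    ⟨n, hn, le_rfl, hw.le_last, fun j hj hjn => by omega⟩
  obtain ⟨h1, h2⟩ := Nat.find_spec hex
  refine ⟨Nat.find hex, h1, h2, ?_⟩
  set m := Nat.find hex with hm
  have ht := hw.take h2
  rw [irreducibles, Finset.mem_filter, mem_bridges, card_renewals_eq_one_iff ht.isProfile]
  refine ⟨ht, h1, fun k hk hr => ?_⟩
  refine Nat.find_min hex hr.1 ⟨hk, ?_⟩
  have hkm := hr.1
  have h4 := hr.2.2 m hkm le_rfl
  rw [profile_take w hkm.le, profile_take w le_rfl] at h4
  have hmn := h2.1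
  refine ⟨by omega, fun j hj => ?_, fun j hj hjn => ?_⟩
  · have := hr.2.1 j hj
    rwa [profile_take w (by omega), profile_take w hkm.le] at this
  · rcases le_or_gt j m with hjm' | hjm'
    · have := hr.2.2 j hj hjm'
      rwa [profile_take w hjm', profile_take w hkm.le] at this
    · exact h4.trans (h2.2.2 j hjm' hjn)

/-- The number of bridges of length `n` with `r` renewal times. -/
noncomputable def numRenewals (hd : 2 ≤ d) (n r : ℕ) : ℕ :=
  ((bridges hd n).filter fun w => (renewals n (profile hd w)).card = r).card

/-- Splitting off the first irreducible piece removes exactly one renewal time, and the two pieces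
determine the bridge. -/
lemma numRenewals_succ_le (hd : 2 ≤ d) (n r : ℕ) : numRenewals hd n (r + 1) ≤
    ∑ j ∈ Finset.range (n + 1), (irreducibles hd j).card * numRenewals hd (n - j) r := by
  classical
  simp_rw [numRenewals, ← Finset.card_product]
  rw [← Finset.card_sigma]
  have hch : ∀ w : ℕ → Fin d → ℤ, ∃ m, 0 < n → IsBridge hd n w → 0 < m ∧
      IsCut n (profile hd w) m ∧ take m w ∈ irreducibles hd m := by
    intro w
    by_cases hw : 0 < n ∧ IsBridge hd n w
    · obtain ⟨m, hm⟩ := hw.2.exists_cut hw.1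
      exact ⟨m, fun _ _ => hm⟩
    · exact ⟨0, fun h h' => absurd ⟨h, h'⟩ hw⟩
  choose M hM using hch
  have hnpos : ∀ w ∈ (bridges hd n).filter fun w => (renewals n (profile hd w)).card = r + 1,
      0 < n := by
    intro w hw
    rcases Nat.eq_zero_or_pos n with rfl | hn
    · simp [renewals] at hw
    · exact hn
  refine Finset.card_le_card_of_injOn
    (fun w => (⟨M w, (take (M w) w, drop (M w) w)⟩ :
      Σ _ : ℕ, (ℕ → Fin d → ℤ) × (ℕ → Fin d → ℤ))) ?_ ?_
  · intro w hw
    have hn := hnpos w hw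
    simp only [Finset.coe_filter, Set.mem_ofPred_eq, mem_bridges] at hw
    obtain ⟨h1, h2, h3⟩ := hM w hn hw.1
    have hmn := h2.1
    simp only [Finset.coe_sigma, Set.mem_sigma_iff, Finset.mem_coe, Finset.mem_range,
      Finset.mem_product, Finset.mem_filter, mem_bridges]
    obtain ⟨k, hk⟩ := Nat.exists_eq_add_of_le hmn
    generalize M w = m at *
    subst hk
    rw [Nat.add_sub_cancel_left]
    refine ⟨by omega, h3, hw.1.drop h2, ?_⟩
    have h4 := card_renewals_cut h2
    have h5 := (Finset.mem_filter.1 h3).2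
    omega
  · intro w hw w' hw' e
    simp only [Sigma.mk.injEq] at e
    obtain ⟨e1, e2⟩ := e
    rw [heq_eq_eq, Prod.mk.injEq] at e2
    rw [← concat_take_drop (M w) w, ← concat_take_drop (M w') w', e2.1, e2.2, e1]

/-- Concatenation is injective here: of two different irreducible initial pieces of one bridge, the
shorter would end at a renewal time inside the longer. -/
lemma sum_card_irreducibles_mul_le (hd : 2 ≤ d) (n : ℕ) :
    ∑ j ∈ Finset.range (n + 1), (irreducibles hd j).card * (bridges hd (n - j)).card ≤
      (bridges hd n).card := by
  classical
  simp_rw [← Finset.card_product]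
  rw [← Finset.card_sigma]
  have key : ∀ (m m' : ℕ) (w : ℕ → Fin d → ℤ), IsCut n (profile hd w) m →
      take m w ∈ irreducibles hd m → take m' w ∈ irreducibles hd m' → m' ≤ n → ¬ m < m' := by
    intro m m' w hc hm hm' hmn hlt
    have h1 := Finset.mem_filter.1 hm
    have h2 := Finset.mem_filter.1 hm'
    rw [card_renewals_eq_one_iff (mem_bridges.1 h1.1).isProfile] at h1
    rw [card_renewals_eq_one_iff (mem_bridges.1 h2.1).isProfile] at h2
    refine h2.2.2 m h1.2.1 ⟨hlt, fun j hj => ?_, fun j hj hjm => ?_⟩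
    · rw [profile_take w (by omega), profile_take w hlt.le]
      exact hc.2.1 j hj
    · rw [profile_take w hjm, profile_take w hlt.le]
      exact hc.2.2 j hj (by omega)
  refine Finset.card_le_card_of_injOn (fun x => concat x.1 x.2.1 x.2.2) ?_ ?_
  · rintro ⟨m, u, v⟩ hx
    simp only [Finset.coe_sigma, Set.mem_sigma_iff, Finset.mem_coe, Finset.mem_range,
      Finset.mem_product, irreducibles, Finset.mem_filter, mem_bridges] at hx ⊢
    have := hx.2.1.1.concat hx.2.2
    rwa [Nat.add_sub_cancel' (by omega)] at this
  · rintro ⟨m, u, v⟩ hx ⟨m', u', v'⟩ hx' e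
    simp only [Finset.coe_sigma, Set.mem_sigma_iff, Finset.mem_coe, Finset.mem_range,
      Finset.mem_product] at hx hx' e
    obtain ⟨hm, hu, hv⟩ := hx
    obtain ⟨hm', hu', hv'⟩ := hx'
    rw [mem_bridges] at hv hv'
    have hub := mem_bridges.1 (Finset.mem_filter.1 hu).1
    have hub' := mem_bridges.1 (Finset.mem_filter.1 hu').1
    have hc := isCut_concat hub hv
    have hc' := isCut_concat hub' hv'
    rw [Nat.add_sub_cancel' (by omega)] at hc hc'
    have ht := take_concat hub.walk v
    have ht' := take_concat hub'.walk v'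
    have hmm : m = m' := by
      rcases lt_trichotomy m m' with h | h | h
      · refine absurd h (key m m' _ hc (by rwa [ht]) ?_ (by omega))
        rw [e, ht']
        exact hu'
      · exact h
      · refine absurd h (key m' m _ hc' (by rwa [ht']) ?_ (by omega))
        rw [← e, ht]
        exact hu
    subst hmm
    rw [e, ht'] at ht
    have hd1 := drop_concat m u hv.walk.zero
    rw [e, drop_concat m u' hv'.walk.zero] at hd1
    rw [ht, hd1]

lemma card_bridges_mul_le (hd : 2 ≤ d) (m n : ℕ) :
    (bridges hd m).card * (bridges hd n).card ≤ (bridges hd (m + n)).card := by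
  rw [← Finset.card_product]
  refine Finset.card_le_card_of_injOn (fun x => concat m x.1 x.2) ?_ ?_
  · rintro ⟨u, v⟩ hx
    simp only [Finset.coe_product, Set.mem_prod, Finset.mem_coe, mem_bridges] at hx ⊢
    exact hx.1.concat hx.2
  · rintro ⟨u, v⟩ hx ⟨u', v'⟩ hx' e
    simp only [Finset.coe_product, Set.mem_prod, Finset.mem_coe, mem_bridges] at hx hx' e
    have h1 := congrArg (take m) e
    have h2 := congrArg (drop m) e
    rw [take_concat hx.1.walk, take_concat hx'.1.walk] at h1
    rw [drop_concat m u hx.2.walk.zero, drop_concat m u' hx'.2.walk.zero] at h2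
    rw [h1, h2]

lemma card_walks_add_le (d m n : ℕ) :
    (walks d (m + n)).card ≤ (walks d m).card * (walks d n).card := by
  rw [← Finset.card_product]
  refine Finset.card_le_card_of_injOn (fun w => (take m w, drop m w)) ?_ ?_
  · intro w hw
    simp only [Finset.coe_product, Set.mem_prod, Finset.mem_coe, mem_walks] at hw ⊢
    exact ⟨hw.take (by omega), hw.drop⟩
  · intro w hw w' hw' e
    simp only [Prod.mk.injEq] at e
    rw [← concat_take_drop m w, ← concat_take_drop m w', e.1, e.2]

lemma bridges_nonempty (hd : 2 ≤ d) (n : ℕ) : (bridges hd n).Nonempty := by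
  have hprof : ∀ i, profile hd (fun i => Pi.single ⟨1, hd⟩ ((min i n : ℕ) : ℤ)) i = (min i n : ℕ) := by
    intro i
    simp [profile, y]
  refine ⟨fun i => Pi.single ⟨1, hd⟩ ((min i n : ℕ) : ℤ), mem_bridges.2
    ⟨⟨by simp, fun i hi => ?_, fun i j hij hj e => ?_, fun i hi => by simp [hi]⟩,
      fun j hj hjn => ?_, fun j hjn => ?_⟩⟩
  · rw [IsBond, Finset.sum_eq_single_of_mem ⟨1, hd⟩ (Finset.mem_univ _)]
    · simp only [Pi.single_eq_same]
      rw [min_eq_left hi.le, min_eq_left (by omega)]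
      simp
    · intro k _ hk
      simp [hk]
  · have h1 := hprof i
    have h2 := hprof j
    rw [profile, e] at h1
    rw [profile] at h2
    omega
  · rw [hprof]; omega
  · rw [hprof, hprof]; omega

/-! ### Exponentially small families of bridges -/

section ExpSmall

variable {hd : 2 ≤ d}

open Classical in
/-- The proportion of bridges of length `n` that satisfy `G n` decays exponentially fast. -/
def IsExpSmall (hd : 2 ≤ d) (G : ℕ → (ℕ → Fin d → ℤ) → Prop) : Prop :=
  ∃ c : ℝ, 0 < c ∧ ∀ᶠ n : ℕ in atTop,
    (((bridges hd n).filter (G n)).card : ℝ) ≤ Real.exp (-(c * n)) * (bridges hd n).card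

lemma eventually_const_mul_exp_le (C : ℝ) {c : ℝ} (hc : 0 < c) :
    ∀ᶠ n : ℕ in atTop, C * Real.exp (-(c * n)) ≤ Real.exp (-(c / 2 * n)) := by
  have h1 : Tendsto (fun n : ℕ => Real.exp (c / 2 * n)) atTop atTop :=
    Real.tendsto_exp_atTop.comp
      (Tendsto.const_mul_atTop (half_pos hc) tendsto_natCast_atTop_atTop)
  filter_upwards [h1.eventually_ge_atTop C] with n hn
  calc C * Real.exp (-(c * n)) ≤ Real.exp (c / 2 * n) * Real.exp (-(c * n)) := by gcongr
    _ = Real.exp (-(c / 2 * n)) := by rw [← Real.exp_add]; ring_nf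

/-- Halving the rate absorbs the constant. -/
lemma IsExpSmall.of_le_const_mul {G : ℕ → (ℕ → Fin d → ℤ) → Prop}
    [∀ n, DecidablePred (G n)] {C c : ℝ} (hc : 0 < c)
    (h : ∀ᶠ n : ℕ in atTop, (((bridges hd n).filter (G n)).card : ℝ) ≤
      C * Real.exp (-(c * n)) * (bridges hd n).card) : IsExpSmall hd G := by
  refine ⟨c / 2, half_pos hc, ?_⟩
  filter_upwards [h, eventually_const_mul_exp_le C hc] with n h1 h2
  refine le_trans ?_ (h1.trans (mul_le_mul_of_nonneg_right h2 (Nat.cast_nonneg _)))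
  rw [Nat.cast_le]
  exact (Finset.card_le_card fun w hw => by simpa using hw)

lemma IsExpSmall.mono {G G' : ℕ → (ℕ → Fin d → ℤ) → Prop} (h : IsExpSmall hd G')
    (hG : ∀ᶠ n in atTop, ∀ w, IsBridge hd n w → G n w → G' n w) : IsExpSmall hd G := by
  classical
  obtain ⟨c, hc, h⟩ := h
  refine ⟨c, hc, ?_⟩
  filter_upwards [h, hG] with n h1 h2
  refine le_trans ?_ h1
  gcongr 1
  refine Finset.card_le_card fun w hw => ?_
  rw [Finset.mem_filter] at hw ⊢
  exact ⟨hw.1, h2 w (mem_bridges.1 hw.1) hw.2⟩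

lemma IsExpSmall.or {G G' : ℕ → (ℕ → Fin d → ℤ) → Prop} (h : IsExpSmall hd G)
    (h' : IsExpSmall hd G') : IsExpSmall hd fun n w => G n w ∨ G' n w := by
  classical
  obtain ⟨c, hc, h⟩ := h
  obtain ⟨c', hc', h'⟩ := h'
  refine IsExpSmall.of_le_const_mul (C := 2) (lt_min hc hc') ?_
  filter_upwards [h, h'] with n h1 h2
  rw [Finset.filter_or]
  have h3 : ((((bridges hd n).filter (G n)) ∪ ((bridges hd n).filter (G' n))).card : ℝ) ≤
      ((bridges hd n).filter (G n)).card + ((bridges hd n).filter (G' n)).card := by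
    exact_mod_cast Finset.card_union_le _ _
  have h4 : Real.exp (-(c * n)) ≤ Real.exp (-(min c c' * n)) := by
    gcongr; exact min_le_left _ _
  have h5 : Real.exp (-(c' * n)) ≤ Real.exp (-(min c c' * n)) := by
    gcongr; exact min_le_right _ _
  calc _ ≤ _ := h3
    _ ≤ Real.exp (-(min c c' * n)) * (bridges hd n).card +
        Real.exp (-(min c c' * n)) * (bridges hd n).card :=
      add_le_add (h1.trans (by gcongr)) (h2.trans (by gcongr))
    _ = _ := by ring

/-- A Chernoff bound: give each subset `A` the weight `exp (-s |A|)`. The total is `(1 + exp (-s)) ^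
n`, at most `exp (c n / 2)` once `exp (-s) ≤ c / 2`, while each small subset weighs at least `exp
(-c n / 2)` when `η = c / (2 s)`. -/
lemma exists_card_small_subsets_le {c : ℝ} (hc : 0 < c) : ∃ η : ℝ, 0 < η ∧ ∀ n : ℕ,
    (((Finset.range n).powerset.filter fun A => (A.card : ℝ) ≤ η * n).card : ℝ) ≤
      Real.exp (c * n) := by
  set s : ℝ := 1 + 2 / c with hs
  have hs0 : 0 < s := by positivity
  have hes : Real.exp (-s) ≤ c / 2 := by
    rw [Real.exp_neg, inv_le_comm₀ (Real.exp_pos _) (by positivity), inv_div]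
    have := Real.add_one_le_exp s
    linarith
  refine ⟨c / (2 * s), by positivity, fun n => ?_⟩
  set P := (Finset.range n).powerset.filter fun A => (A.card : ℝ) ≤ c / (2 * s) * n with hP
  have h1 : (P.card : ℝ) * Real.exp (-(c / 2 * n)) ≤ Real.exp (c / 2 * n) := by
    calc (P.card : ℝ) * Real.exp (-(c / 2 * n)) = ∑ A ∈ P, Real.exp (-(c / 2 * n)) := by
          rw [Finset.sum_const, nsmul_eq_mul]
      _ ≤ ∑ A ∈ P, Real.exp (-s) ^ A.card := by
          refine Finset.sum_le_sum fun A hA => ?_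
          rw [← Real.exp_nat_mul, Real.exp_le_exp]
          have h2 := mul_le_mul_of_nonneg_left (Finset.mem_filter.1 hA).2 hs0.le
          have h3 : s * (c / (2 * s) * n) = c / 2 * n := by field_simp
          rw [h3] at h2
          linarith
      _ ≤ ∑ A ∈ (Finset.range n).powerset, Real.exp (-s) ^ A.card :=
          Finset.sum_le_sum_of_subset_of_nonneg (Finset.filter_subset _ _)
            fun _ _ _ => by positivity
      _ = (Real.exp (-s) + 1) ^ n := by
          have := Finset.sum_pow_mul_eq_add_pow (Real.exp (-s)) 1 (Finset.range n)
          simpa using this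
      _ ≤ Real.exp (c / 2) ^ n := by
          gcongr
          have := Real.add_one_le_exp (c / 2)
          linarith
      _ = Real.exp (c / 2 * n) := by rw [← Real.exp_nat_mul, mul_comm]
  calc (P.card : ℝ) = P.card * Real.exp (-(c / 2 * n)) * Real.exp (c / 2 * n) := by
        rw [mul_assoc, ← Real.exp_add]; simp
    _ ≤ Real.exp (c / 2 * n) * Real.exp (c / 2 * n) := by gcongr
    _ = Real.exp (c * n) := by rw [← Real.exp_add]; ring_nf

/-- Induction on `m`, keeping a single term of Vandermonde's identity. -/
lemma pow_le_choose_mul (q m : ℕ) : q ^ m ≤ (m * q).choose m := by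
  induction m with
  | zero => simp
  | succ m ih =>
    rw [Nat.succ_mul, Nat.add_choose_eq, pow_succ]
    calc q ^ m * q ≤ (m * q).choose m * q.choose 1 := by
          rw [Nat.choose_one_right]; gcongr
      _ ≤ _ := Finset.single_le_sum
          (f := fun ij : ℕ × ℕ => (m * q).choose ij.1 * q.choose ij.2)
          (fun _ _ => Nat.zero_le _) (show (m, 1) ∈ _ by simp)

/-- Unfolding all of few folds loses little entropy. -/
lemma IsExpSmall.unfold_few {δ : ℝ} {k : ℕ}
    (h : IsExpSmall hd fun n w => δ * n ≤ (lowLevels n k (profile hd w)).card) :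
    ∃ η : ℝ, 0 < η ∧ IsExpSmall hd fun n w =>
      δ * n ≤ (lowLevels n k (flip (foldSigns (folds n (profile hd w))) (profile hd w))).card ∧
        ((folds n (profile hd w)).card : ℝ) ≤ η * n := by
  classical
  obtain ⟨c, hc, h⟩ := h
  -- Two sets of endpoints are recorded, each costing a factor `exp (c n / 4)`, which leaves half of
  -- the rate `c`.
  obtain ⟨η, hη, hP⟩ := exists_card_small_subsets_le (c := c / 4) (by positivity)
  refine ⟨η, hη, IsExpSmall.of_le_const_mul (C := 1) (c := c / 2) (by positivity) ?_⟩
  filter_upwards [h] with n hn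
  set G := (bridges hd n).filter fun w => δ * n ≤
    (lowLevels n k (flip (foldSigns (folds n (profile hd w))) (profile hd w))).card ∧
        ((folds n (profile hd w)).card : ℝ) ≤ η * n with hG
  set G' := (bridges hd n).filter fun w => δ * n ≤ (lowLevels n k (profile hd w)).card with hG'
  set P := (Finset.range n).powerset.filter fun A => (A.card : ℝ) ≤ η * n with hPdef
  have hcard : G.card ≤ (G' ×ˢ (P ×ˢ P)).card := by
    refine Finset.card_le_card_of_injOn (fun w => (unfold hd (foldSigns (folds n (profile hd w))) w,
      ((folds n (profile hd w)).image Prod.fst, (folds n (profile hd w)).image Prod.snd))) ?_ ?_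
    · intro w hw
      obtain ⟨h1, h2, h3⟩ := Finset.mem_filter.1 (Finset.mem_coe.1 hw)
      have hb := mem_bridges.1 h1
      rw [Finset.mem_coe, Finset.mem_product, Finset.mem_product]
      refine ⟨Finset.mem_filter.2 ⟨mem_bridges.2 (hb.unfold_foldSigns (Finset.Subset.refl _)), ?_⟩,
        Finset.mem_filter.2 ⟨Finset.mem_powerset.2 ?_, ?_⟩,
        Finset.mem_filter.2 ⟨Finset.mem_powerset.2 ?_, ?_⟩⟩
      · rwa [profile_unfold]
      · intro a ha
        obtain ⟨p, hp, rfl⟩ := Finset.mem_image.1 ha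
        have hf := mem_folds.1 hp
        exact Finset.mem_range.2 (hf.lt.trans_le hf.le)
      · exact le_trans (by exact_mod_cast Finset.card_image_le) h3
      · intro a ha
        obtain ⟨p, hp, rfl⟩ := Finset.mem_image.1 ha
        have hf := mem_folds.1 hp
        exact Finset.mem_range.2 (hf.lt_length hb.isProfile)
      · exact le_trans (by exact_mod_cast Finset.card_image_le) h3
    · intro w _ w' _ e
      simp only [Prod.mk.injEq] at e
      exact (unfold_injective (Finset.Subset.refl _) (Finset.Subset.refl _) e.1 e.2.1 e.2.2).1
  rw [Finset.card_product, Finset.card_product] at hcard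
  calc (G.card : ℝ) ≤ G'.card * (P.card * P.card) := by exact_mod_cast hcard
    _ ≤ (Real.exp (-(c * n)) * (bridges hd n).card) *
        (Real.exp (c / 4 * n) * Real.exp (c / 4 * n)) := by
        have := hP n
        gcongr
    _ = (Real.exp (-(c * n)) * (Real.exp (c / 4 * n) * Real.exp (c / 4 * n))) *
        (bridges hd n).card := by ring
    _ = 1 * Real.exp (-(c / 2 * n)) * (bridges hd n).card := by
        rw [← Real.exp_add, ← Real.exp_add, one_mul]; ring_nf

/-- Few bridges have many folds and few renewal times: unfolding a small proportion of the short
folds gains entropy. -/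
lemma isExpSmall_many_folds (hd : 2 ≤ d) {η : ℝ} (hη : 0 < η) :
    ∃ κ : ℝ, 0 < κ ∧ IsExpSmall hd fun n w =>
      η * n < (folds n (profile hd w)).card ∧ ((renewals n (profile hd w)).card : ℝ) < κ * n := by
  classical
  -- Folds have total length at most `n`, so at most `η n / 2` of them are longer than `L`. The
  -- value of `q` makes `q ^ m` equal to `2 ^ m * 4 ^ K`, and that of `κ` gives `κ q = η / 2`, the
  -- guaranteed density of short folds.
  obtain ⟨L, hL⟩ := exists_nat_ge (2 / η)
  set q : ℕ := 2 * 4 ^ (1 + 3 * L) with hq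
  have hq0 : 0 < q := by positivity
  have hκ : 0 < η / (2 * q) := by positivity
  refine ⟨η / (2 * q), hκ, ?_⟩
  set κ := η / (2 * q) with hκdef
  -- The constant `2` pays for rounding `κ n` down to `m`.
  refine IsExpSmall.of_le_const_mul (C := 2) (c := κ * Real.log 2)
    (mul_pos hκ (Real.log_pos one_lt_two)) (Eventually.of_forall fun n => ?_)
  set G := (bridges hd n).filter fun w => η * n < (folds n (profile hd w)).card ∧
    ((renewals n (profile hd w)).card : ℝ) < κ * n with hG
  set m := ⌊κ * n⌋₊ with hm
  have hmκ : (m : ℝ) ≤ κ * n := Nat.floor_le (by positivity)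
  have hκm : κ * n < m + 1 := Nat.lt_floor_add_one _
  set short : (ℕ → Fin d → ℤ) → Finset (ℕ × ℕ) := fun w =>
    (folds n (profile hd w)).filter fun p => p.2 - p.1 ≤ L with hshort
  have hshort_card : ∀ w ∈ G, m * q ≤ (short w).card := by
    intro w hw
    obtain ⟨h1, h2, h3⟩ := Finset.mem_filter.1 hw
    have h4 := Finset.card_filter_add_card_filter_not (s := folds n (profile hd w))
      (fun p => p.2 - p.1 ≤ L)
    set long := (folds n (profile hd w)).filter fun p => ¬ p.2 - p.1 ≤ L with hlong
    have h5 : long.card * L ≤ n := by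
      rw [← smul_eq_mul]
      calc _ ≤ ∑ p ∈ long, (p.2 - p.1) := Finset.card_nsmul_le_sum _ _ _ fun p hp => by
            have := (Finset.mem_filter.1 hp).2
            omega
        _ ≤ ∑ p ∈ folds n (profile hd w), (p.2 - p.1) :=
            Finset.sum_le_sum_of_subset (Finset.filter_subset _ _)
        _ ≤ n := sum_length_folds_le n _
    have h6 : (long.card : ℝ) ≤ η * n / 2 := by
      have h7 : (long.card : ℝ) * (2 / η) ≤ n := by
        calc (long.card : ℝ) * (2 / η) ≤ long.card * L := by gcongr
          _ ≤ n := by exact_mod_cast h5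
      rw [mul_div_assoc', div_le_iff₀ hη] at h7
      linarith
    have h8 : ((short w).card : ℝ) + long.card = (folds n (profile hd w)).card := by
      exact_mod_cast h4
    have h9 : (m : ℝ) * q ≤ (short w).card := by
      calc (m : ℝ) * q ≤ κ * n * q := by gcongr
        _ = η * n / 2 := by rw [hκdef]; field_simp
        _ ≤ _ := by linarith
    exact_mod_cast h9
  set K := (1 + 3 * L) * m with hK
  set T := ((bridges hd n).filter fun w => (renewals n (profile hd w)).card ≤ K).sigma fun w =>
    (renewals n (profile hd w)).powerset ×ˢ (renewals n (profile hd w)).powerset with hT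
  -- Double counting of pairs (bridge, `m` of its short folds). Unfolding leaves at most `m + 3 L m
  -- = K` renewal times, among which both endpoint sets must be found, so an unfolded bridge has at
  -- most `4 ^ K` preimages.
  have hcard : (G.sigma fun w => (short w).powersetCard m).card ≤ T.card := by
    refine Finset.card_le_card_of_injOn (fun x => ⟨unfold hd (foldSigns x.2) x.1,
      (x.2.image Prod.fst, x.2.image Prod.snd)⟩) ?_ ?_
    · rintro ⟨w, S⟩ hx
      obtain ⟨hw, hS⟩ := Finset.mem_sigma.1 (Finset.mem_coe.1 hx)
      dsimp only at hw hS
      obtain ⟨hSs, hSm⟩ := Finset.mem_powersetCard.1 hS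
      obtain ⟨h1, h2, h3⟩ := Finset.mem_filter.1 hw
      have hb := mem_bridges.1 h1
      have hSf : S ⊆ folds n (profile hd w) := hSs.trans (Finset.filter_subset _ _)
      obtain ⟨-, -, h4, h5⟩ := isProfile_foldSigns hb.isProfile hSf
      rw [Finset.mem_coe, Finset.mem_sigma, Finset.mem_product, Finset.mem_filter,
        Finset.mem_powerset, Finset.mem_powerset]
      dsimp only
      rw [profile_unfold]
      refine ⟨⟨mem_bridges.2 (hb.unfold_foldSigns hSf), ?_⟩, ?_, ?_⟩
      · have h6 : ∑ p ∈ S, 3 * (p.2 - p.1) ≤ S.card • (3 * L) :=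
          Finset.sum_le_card_nsmul _ _ _ fun p hp => by
            have := (Finset.mem_filter.1 (hSs hp)).2
            omega
        rw [smul_eq_mul, hSm] at h6
        have h7 : (renewals n (profile hd w)).card < m + 1 := by
          exact_mod_cast h3.trans hκm
        have : K = m + m * (3 * L) := by rw [hK]; ring
        omega
      · intro a ha
        obtain ⟨p, hp, rfl⟩ := Finset.mem_image.1 ha
        exact mem_renewals.2 (h4 p hp).1
      · intro a ha
        obtain ⟨p, hp, rfl⟩ := Finset.mem_image.1 ha
        exact mem_renewals.2 (h4 p hp).2
    · rintro ⟨w, S⟩ hx ⟨w', S'⟩ hx' e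
      obtain ⟨-, hS⟩ := Finset.mem_sigma.1 (Finset.mem_coe.1 hx)
      obtain ⟨-, hS'⟩ := Finset.mem_sigma.1 (Finset.mem_coe.1 hx')
      simp only [Sigma.mk.injEq] at e
      obtain ⟨e1, e2⟩ := e
      rw [heq_eq_eq, Prod.mk.injEq] at e2
      obtain ⟨rfl, rfl⟩ := unfold_injective
        ((Finset.mem_powersetCard.1 hS).1.trans (Finset.filter_subset _ _))
        ((Finset.mem_powersetCard.1 hS').1.trans (Finset.filter_subset _ _)) e1 e2.1 e2.2
      rfl
  have hlow : G.card * q ^ m ≤ (G.sigma fun w => (short w).powersetCard m).card := by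
    rw [Finset.card_sigma, ← smul_eq_mul]
    refine Finset.card_nsmul_le_sum _ _ _ fun w hw => ?_
    rw [Finset.card_powersetCard]
    exact (pow_le_choose_mul q m).trans (Nat.choose_le_choose m (hshort_card w hw))
  have hup : T.card ≤ (bridges hd n).card * 4 ^ K := by
    rw [hT, Finset.card_sigma]
    refine (Finset.sum_le_card_nsmul _ _ (4 ^ K) fun w hw => ?_).trans ?_
    · rw [Finset.card_product, Finset.card_powerset, ← mul_pow]
      exact Nat.pow_le_pow_right (by norm_num) (Finset.mem_filter.1 hw).2
    · rw [smul_eq_mul]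
      exact Nat.mul_le_mul_right _ (Finset.card_filter_le _ _)
  have hfin : G.card * 2 ^ m ≤ (bridges hd n).card := by
    have h1 := hlow.trans (hcard.trans hup)
    rw [hq, mul_pow, ← pow_mul, ← mul_assoc] at h1
    exact Nat.le_of_mul_le_mul_right h1 (by positivity)
  have hfin' : (G.card : ℝ) * 2 ^ m ≤ (bridges hd n).card := by exact_mod_cast hfin
  have h2m : Real.exp (κ * Real.log 2 * n) ≤ 2 * 2 ^ m := by
    have h3 : (2 : ℝ) * 2 ^ m = Real.exp (Real.log 2 * (m + 1)) := by
      rw [mul_add, Real.exp_add, mul_one, Real.exp_log two_pos, mul_comm (Real.log 2),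
        Real.exp_nat_mul, Real.exp_log two_pos, mul_comm]
    rw [h3, Real.exp_le_exp]
    have := mul_le_mul_of_nonneg_left hκm.le (Real.log_pos one_lt_two).le
    linarith
  have hexp := Real.exp_pos (κ * Real.log 2 * n)
  rw [Real.exp_neg, mul_comm (2 : ℝ), mul_assoc, inv_mul_eq_div, le_div_iff₀ hexp]
  calc (G.card : ℝ) * Real.exp (κ * Real.log 2 * n) ≤ G.card * (2 * 2 ^ m) := by gcongr
    _ = 2 * (G.card * 2 ^ m) := by ring
    _ ≤ _ := by gcongr

/-- If many renewal times are exponentially unlikely, so are many levels that are visited a bounded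
number of times. -/
lemma isExpSmall_lowLevels
    (h : ∀ δ : ℝ, 0 < δ → IsExpSmall hd fun n w => δ * n ≤ (renewals n (profile hd w)).card)
    (k : ℕ) {δ : ℝ} (hδ : 0 < δ) :
    IsExpSmall hd fun n w => δ * n ≤ (lowLevels n k (profile hd w)).card := by
  induction k generalizing δ with
  | zero =>
    refine (h δ hδ).mono (Eventually.of_forall fun n w hw hl => hl.trans ?_)
    rw [lowLevels_zero hw.isProfile]
    simp
  | succ k ih =>
    obtain ⟨η, hη, h1⟩ := (ih (half_pos hδ)).unfold_few
    obtain ⟨κ, hκ, h2⟩ := isExpSmall_many_folds hd hη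
    refine ((h (min κ (δ / 2)) (lt_min hκ (half_pos hδ))).or (h1.or h2)).mono
      (Eventually.of_forall fun n w hw hl => ?_)
    by_cases hR : min κ (δ / 2) * n ≤ (renewals n (profile hd w)).card
    · exact Or.inl hR
    right
    rw [not_le] at hR
    rcases le_or_gt ((folds n (profile hd w)).card : ℝ) (η * n) with hf | hf
    · left
      refine ⟨?_, hf⟩
      have h3 : ((lowLevels n (k + 1) (profile hd w)).card : ℝ) ≤
          (renewals n (profile hd w)).card + (lowLevels n k
            (flip (foldSigns (folds n (profile hd w))) (profile hd w))).card := by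
        exact_mod_cast card_lowLevels_le k hw.isProfile
      have h4 : min κ (δ / 2) * n ≤ δ / 2 * n := by gcongr; exact min_le_right _ _
      linarith
    · right
      refine ⟨hf, hR.trans_le ?_⟩
      gcongr
      exact min_le_left _ _

/-- If many renewal times are exponentially unlikely, so is ballistic behaviour. -/
lemma isExpSmall_ballistic
    (h : ∀ δ : ℝ, 0 < δ → IsExpSmall hd fun n w => δ * n ≤ (renewals n (profile hd w)).card)
    {v : ℝ} (hv : 0 < v) : IsExpSmall hd fun n w => v * n ≤ (profile hd w n : ℝ) := by
  -- Levels visited more than `k` times number at most `(n + 1) / (k + 1)`, which this choice keeps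
  -- below `v n / 2`.
  obtain ⟨k, hk⟩ := exists_nat_ge (4 / v)
  refine (isExpSmall_lowLevels h k (half_pos hv)).mono ?_
  filter_upwards [eventually_ge_atTop 1] with n hn w hw hl
  have h1 := height_le_card_lowLevels (n := n) k (profile hd w)
  have h2 : (profile hd w n : ℝ) ≤ (profile hd w n).toNat := by
    exact_mod_cast Int.self_le_toNat _
  have h3 : ((k : ℝ) + 1) * (profile hd w n).toNat ≤
      (k + 1) * (lowLevels n k (profile hd w)).card + (n + 1) := by exact_mod_cast h1
  have hn' : (1 : ℝ) ≤ n := by exact_mod_cast hn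
  have h4 : (n : ℝ) + 1 ≤ (k + 1) * (v / 2 * n) := by
    have h5 : 2 ≤ (k + 1) * (v / 2) := by
      rw [div_le_iff₀ hv] at hk
      nlinarith
    nlinarith
  have hk0 : (0 : ℝ) < k + 1 := by positivity
  have h6 : ((k : ℝ) + 1) * (v / 2 * n) ≤ (k + 1) * (lowLevels n k (profile hd w)).card := by
    have := mul_le_mul_of_nonneg_left (hl.trans h2) hk0.le
    linarith
  exact le_of_mul_le_mul_left h6 hk0

end ExpSmall

/-! ### Growth rates -/

lemma card_bridges_le_card_walks (hd : 2 ≤ d) (n : ℕ) :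
    (bridges hd n).card ≤ (walks d n).card :=
  Finset.card_le_card fun _ hw => mem_walks.2 (mem_bridges.1 hw).walk

lemma card_bridges_pos (hd : 2 ≤ d) (n : ℕ) : 0 < (bridges hd n).card :=
  (bridges_nonempty hd n).card_pos

lemma card_walks_pos (hd : 2 ≤ d) (n : ℕ) : 0 < (walks d n).card :=
  (card_bridges_pos hd n).trans_le (card_bridges_le_card_walks hd n)

lemma subadditive_log_walks (hd : 2 ≤ d) : Subadditive fun n => Real.log (walks d n).card := by
  intro m n
  have hm : (0 : ℝ) < (walks d m).card := by exact_mod_cast card_walks_pos hd m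
  have hn : (0 : ℝ) < (walks d n).card := by exact_mod_cast card_walks_pos hd n
  rw [← Real.log_mul hm.ne' hn.ne']
  refine Real.log_le_log (by exact_mod_cast card_walks_pos hd _) ?_
  exact_mod_cast card_walks_add_le d m n

lemma subadditive_neg_log_bridges (hd : 2 ≤ d) :
    Subadditive fun n => -Real.log (bridges hd n).card := by
  intro m n
  have hm : (0 : ℝ) < (bridges hd m).card := by exact_mod_cast card_bridges_pos hd m
  have hn : (0 : ℝ) < (bridges hd n).card := by exact_mod_cast card_bridges_pos hd n
  rw [← neg_add, ← Real.log_mul hm.ne' hn.ne', neg_le_neg_iff]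
  refine Real.log_le_log (mul_pos hm hn) ?_
  exact_mod_cast card_bridges_mul_le hd m n

lemma log_walks_nonneg (hd : 2 ≤ d) (n : ℕ) : 0 ≤ Real.log (walks d n).card :=
  Real.log_nonneg (by exact_mod_cast card_walks_pos hd n)

lemma log_bridges_nonneg (hd : 2 ≤ d) (n : ℕ) : 0 ≤ Real.log (bridges hd n).card :=
  Real.log_nonneg (by exact_mod_cast card_bridges_pos hd n)

lemma log_bridges_le (hd : 2 ≤ d) (n : ℕ) :
    Real.log (bridges hd n).card ≤ Real.log (walks d n).card :=
  Real.log_le_log (by exact_mod_cast card_bridges_pos hd n)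
    (by exact_mod_cast card_bridges_le_card_walks hd n)

lemma bddBelow_log_walks (hd : 2 ≤ d) :
    BddBelow (Set.range fun n : ℕ => Real.log (walks d n).card / n) := by
  refine ⟨0, ?_⟩
  rintro _ ⟨n, rfl⟩
  exact div_nonneg (log_walks_nonneg hd n) (Nat.cast_nonneg n)

lemma log_walks_le (hd : 2 ≤ d) (n : ℕ) :
    Real.log (walks d n).card ≤ n * Real.log (walks d 1).card + Real.log (walks d 0).card := by
  induction n with
  | zero => simp
  | succ n ih =>
    have := subadditive_log_walks hd n 1
    push_cast
    linarith

lemma bddBelow_neg_log_bridges (hd : 2 ≤ d) :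
    BddBelow (Set.range fun n : ℕ => -Real.log (bridges hd n).card / n) := by
  refine ⟨-(Real.log (walks d 1).card + Real.log (walks d 0).card), ?_⟩
  rintro _ ⟨n, rfl⟩
  have h0 := log_walks_nonneg hd 0
  have h1 := log_walks_nonneg hd 1
  rcases Nat.eq_zero_or_pos n with rfl | hn
  · simp only [Nat.cast_zero, div_zero]
    linarith
  have hn' : (1 : ℝ) ≤ n := by exact_mod_cast hn
  rw [le_div_iff₀ (by linarith)]
  have h2 := log_walks_le hd n
  have h3 := log_bridges_le hd n
  nlinarith

/-- The logarithm of the exponential growth rate of the number of walks. -/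
noncomputable def walkRate (hd : 2 ≤ d) : ℝ := (subadditive_log_walks hd).lim

/-- The logarithm of the exponential growth rate of the number of bridges. -/
noncomputable def bridgeRate (hd : 2 ≤ d) : ℝ := -(subadditive_neg_log_bridges hd).lim

lemma tendsto_walkRate (hd : 2 ≤ d) :
    Tendsto (fun n : ℕ => Real.log (walks d n).card / n) atTop (𝓝 (walkRate hd)) :=
  (subadditive_log_walks hd).tendsto_lim (bddBelow_log_walks hd)

lemma tendsto_bridgeRate (hd : 2 ≤ d) :
    Tendsto (fun n : ℕ => Real.log (bridges hd n).card / n) atTop (𝓝 (bridgeRate hd)) := by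
  have := ((subadditive_neg_log_bridges hd).tendsto_lim (bddBelow_neg_log_bridges hd)).neg
  simpa [neg_div, bridgeRate] using this

/-- The two rates are in fact equal (Hammersley and Welsh), but the easy inequality is enough for
the final comparison. -/
lemma bridgeRate_le_walkRate (hd : 2 ≤ d) : bridgeRate hd ≤ walkRate hd :=
  le_of_tendsto_of_tendsto' (tendsto_bridgeRate hd) (tendsto_walkRate hd) fun n =>
    div_le_div_of_nonneg_right (log_bridges_le hd n) (Nat.cast_nonneg n)

lemma bridgeRate_nonneg (hd : 2 ≤ d) : 0 ≤ bridgeRate hd :=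
  ge_of_tendsto' (tendsto_bridgeRate hd) fun n =>
    div_nonneg (log_bridges_nonneg hd n) (Nat.cast_nonneg n)

lemma card_bridges_zero (hd : 2 ≤ d) : (bridges hd 0).card = 1 := by
  have h1 := card_bridges_mul_le hd 0 0
  have h2 := card_bridges_pos hd 0
  rw [add_zero] at h1
  exact le_antisymm (Nat.le_of_mul_le_mul_right (by simpa using h1) h2) h2

/-- By Fekete's lemma the rate is a supremum, so this upper bound has no subexponential correction.
-/
lemma card_bridges_le_exp (hd : 2 ≤ d) (n : ℕ) :
    ((bridges hd n).card : ℝ) ≤ Real.exp (bridgeRate hd * n) := by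
  rcases Nat.eq_zero_or_pos n with rfl | hn
  · simp [card_bridges_zero]
  have h1 := (subadditive_neg_log_bridges hd).lim_le_div (bddBelow_neg_log_bridges hd) hn.ne'
  have hn' : (0 : ℝ) < n := by exact_mod_cast hn
  rw [le_div_iff₀ hn'] at h1
  rw [← Real.log_le_iff_le_exp (by exact_mod_cast card_bridges_pos hd n), bridgeRate]
  linarith

lemma eventually_exp_le_card_bridges (hd : 2 ≤ d) {ε : ℝ} (hε : 0 < ε) :
    ∀ᶠ n : ℕ in atTop, Real.exp ((bridgeRate hd - ε) * n) ≤ (bridges hd n).card := by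
  filter_upwards [(tendsto_bridgeRate hd).eventually (lt_mem_nhds (sub_lt_self _ hε)),
    eventually_gt_atTop 0] with n h1 hn
  have hn' : (0 : ℝ) < n := by exact_mod_cast hn
  rw [lt_div_iff₀ hn'] at h1
  rw [← Real.le_log_iff_exp_le (by exact_mod_cast card_bridges_pos hd n)]
  exact h1.le

/-! ### The generating function of irreducible bridges -/

lemma card_irreducibles_zero (hd : 2 ≤ d) : (irreducibles hd 0).card = 0 := by
  rw [Finset.card_eq_zero, Finset.eq_empty_iff_forall_notMem]
  intro w hw
  have := (Finset.mem_filter.1 hw).2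
  simp [renewals] at this

/-- The critical generating function of the irreducible bridges is at most `1`. -/
lemma sum_irreducibles_le_one (hd : 2 ≤ d) (J : ℕ) :
    ∑ j ∈ Finset.range J, (irreducibles hd j).card * Real.exp (-(bridgeRate hd * j)) ≤ 1 := by
  by_contra! hc
  set f : ℝ → ℝ := fun s => ∑ j ∈ Finset.range J, (irreducibles hd j).card * Real.exp (-(s * j))
    with hf
  have hcont : Continuous f := by fun_prop
  -- A finite sum above `1` stays above `1` at a slightly larger rate `s`. The renewal inequality
  -- then forces bridges to grow at rate `s`, which exceeds their true rate.
  obtain ⟨s, hs1, hs2⟩ : ∃ s, bridgeRate hd < s ∧ 1 < f s := by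
    have h1 : ∀ᶠ s in 𝓝[>] bridgeRate hd, 1 < f s :=
      (hcont.continuousAt.eventually (lt_mem_nhds hc)).filter_mono nhdsWithin_le_nhds
    obtain ⟨s, h2, h3⟩ := (h1.and self_mem_nhdsWithin).exists
    exact ⟨s, h3, h2⟩
  have hs0 : 0 < s := (bridgeRate_nonneg hd).trans_lt hs1
  -- The shift by `J` makes the bound trivial for `n ≤ J`; beyond that all `J` terms of `f` are
  -- available in the convolution.
  have hlow : ∀ n : ℕ, Real.exp (s * (n - J)) ≤ (bridges hd n).card := by
    intro n
    induction n using Nat.strong_induction_on with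
    | _ n ih =>
      rcases le_or_gt n J with hn | hn
      · have h1 : (1 : ℝ) ≤ (bridges hd n).card := by exact_mod_cast card_bridges_pos hd n
        refine le_trans ?_ h1
        rw [Real.exp_le_one_iff]
        have : (n : ℝ) ≤ J := by exact_mod_cast hn
        nlinarith
      · have h1 : (∑ j ∈ Finset.range (n + 1), ((irreducibles hd j).card : ℝ) *
            (bridges hd (n - j)).card) ≤ (bridges hd n).card := by
          exact_mod_cast sum_card_irreducibles_mul_le hd n
        refine le_trans ?_ h1
        calc Real.exp (s * (n - J)) ≤ f s * Real.exp (s * (n - J)) :=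
              le_mul_of_one_le_left (Real.exp_pos _).le hs2.le
          _ = ∑ j ∈ Finset.range J, (irreducibles hd j).card *
                (Real.exp (-(s * j)) * Real.exp (s * (n - J))) := by
              rw [hf, Finset.sum_mul]
              exact Finset.sum_congr rfl fun j _ => by ring
          _ ≤ ∑ j ∈ Finset.range J, ((irreducibles hd j).card : ℝ) *
                (bridges hd (n - j)).card := by
              refine Finset.sum_le_sum fun j hj => ?_
              rw [Finset.mem_range] at hj
              rcases Nat.eq_zero_or_pos j with rfl | hj0
              · simp [card_irreducibles_zero]
              refine mul_le_mul_of_nonneg_left ?_ (Nat.cast_nonneg _)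
              refine le_of_eq_of_le ?_ (ih (n - j) (by omega))
              rw [← Real.exp_add, Nat.cast_sub (by omega)]
              ring_nf
          _ ≤ _ := by
              refine Finset.sum_le_sum_of_subset_of_nonneg ?_ fun _ _ _ => by positivity
              exact Finset.range_subset_range.2 (by omega)
  obtain ⟨n, hn⟩ := exists_nat_gt (s * J / (s - bridgeRate hd))
  rw [div_lt_iff₀ (by linarith)] at hn
  have h1 := (hlow n).trans (card_bridges_le_exp hd n)
  rw [Real.exp_le_exp] at h1
  linarith

/-- Each irreducible piece contributes one factor of the generating function, by induction through
`numRenewals_succ_le`. -/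
lemma numRenewals_le (hd : 2 ≤ d) {s A : ℝ} (hA0 : 0 ≤ A)
    (hA : ∀ J, ∑ j ∈ Finset.range J, (irreducibles hd j).card * Real.exp (-(s * j)) ≤ A)
    (n r : ℕ) : (numRenewals hd n r : ℝ) ≤ A ^ r * Real.exp (s * n) := by
  induction r generalizing n with
  | zero =>
    rcases Nat.eq_zero_or_pos n with rfl | hn
    · have h1 : numRenewals hd 0 0 ≤ 1 := by
        rw [← card_bridges_zero hd]
        exact Finset.card_filter_le _ _
      simpa using h1
    · have h1 : numRenewals hd n 0 = 0 := by
        rw [numRenewals, Finset.card_eq_zero, Finset.filter_eq_empty_iff]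
        intro w hw h0
        have := mem_renewals.2 ((mem_bridges.1 hw).isProfile.isRenewal_zero hn)
        rw [Finset.card_eq_zero.1 h0] at this
        simp at this
      rw [h1]
      simp only [Nat.cast_zero]
      positivity
  | succ r ih =>
    have h1 : (numRenewals hd n (r + 1) : ℝ) ≤ ∑ j ∈ Finset.range (n + 1),
        ((irreducibles hd j).card : ℝ) * numRenewals hd (n - j) r := by
      exact_mod_cast numRenewals_succ_le hd n r
    calc _ ≤ _ := h1
      _ ≤ ∑ j ∈ Finset.range (n + 1),
          ((irreducibles hd j).card : ℝ) * (A ^ r * Real.exp (s * (n - j : ℕ))) := by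
          gcongr with j hj
          exact ih _
      _ = (∑ j ∈ Finset.range (n + 1), ((irreducibles hd j).card : ℝ) * Real.exp (-(s * j))) *
          (A ^ r * Real.exp (s * n)) := by
          rw [Finset.sum_mul]
          refine Finset.sum_congr rfl fun j hj => ?_
          rw [Finset.mem_range] at hj
          have : Real.exp (s * (n - j : ℕ)) = Real.exp (-(s * j)) * Real.exp (s * n) := by
            rw [← Real.exp_add, Nat.cast_sub (by omega)]
            ring_nf
          rw [this]
          ring
      _ ≤ A * (A ^ r * Real.exp (s * n)) := by
          gcongr
          exact hA _
      _ = _ := by ring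

lemma one_sub_exp_neg_ge {t : ℝ} (h0 : 0 ≤ t) (h1 : t ≤ 1) : t / 2 ≤ 1 - Real.exp (-t) := by
  have h2 := Real.add_one_le_exp t
  have h3 : Real.exp (-t) ≤ 1 / (t + 1) := by
    rw [Real.exp_neg, ← one_div]
    exact one_div_le_one_div_of_le (by linarith) h2
  have h4 : 1 / (t + 1) ≤ 1 - t / 2 := by
    rw [div_le_iff₀ (by linarith)]
    nlinarith
  linarith

lemma card_renewals_le (n : ℕ) (h : ℕ → ℤ) : (renewals n h).card ≤ n :=
  (Finset.card_le_card fun _ hi => Finset.mem_range.2 (mem_renewals.1 hi).1).trans_eq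
    (Finset.card_range n)

/-- If the mean length of irreducible bridges is infinite, a positive density of renewal times is
exponentially unlikely. -/
lemma isExpSmall_renewals (hd : 2 ≤ d)
    (h : ∀ K : ℝ, ∃ J, K < ∑ j ∈ Finset.range J,
      (j : ℝ) * ((irreducibles hd j).card * Real.exp (-(bridgeRate hd * j))))
    {δ : ℝ} (hδ : 0 < δ) :
    IsExpSmall hd fun n w => δ * n ≤ (renewals n (profile hd w)).card := by
  classical
  -- The truncated mean beyond `4 / δ` gives a drop of at least `2 l / δ` in the generating function
  -- when the rate increases by `l`. Taking `l = 1 / (J + 1)` keeps `l j ≤ 1` for `j < J`, where `1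
  -- - exp (-l j) ≥ l j / 2`.
  obtain ⟨J, hJ⟩ := h (4 / δ)
  set l : ℝ := 1 / (J + 1) with hl
  have hl0 : 0 < l := by positivity
  have hl1 : l ≤ 1 := by
    rw [hl, div_le_one (by positivity)]
    linarith [Nat.cast_nonneg (α := ℝ) J]
  set p : ℕ → ℝ := fun j => (irreducibles hd j).card * Real.exp (-(bridgeRate hd * j)) with hp
  have hp0 : ∀ j, 0 ≤ p j := fun j => by positivity
  set A : ℝ := 1 - l * (2 / δ) with hAdef
  have hA : ∀ J', ∑ j ∈ Finset.range J',
      (irreducibles hd j).card * Real.exp (-((bridgeRate hd + l) * j)) ≤ A := by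
    intro J'
    have e1 : ∀ j : ℕ, (irreducibles hd j).card * Real.exp (-((bridgeRate hd + l) * j)) =
        p j - p j * (1 - Real.exp (-(l * j))) := by
      intro j
      have : Real.exp (-((bridgeRate hd + l) * j)) =
          Real.exp (-(bridgeRate hd * j)) * Real.exp (-(l * j)) := by
        rw [← Real.exp_add]; ring_nf
      rw [this, hp]
      ring
    have hexp : ∀ j : ℕ, Real.exp (-(l * j)) ≤ 1 := fun j => by
      rw [Real.exp_le_one_iff]
      have : 0 ≤ l * j := by positivity
      linarith
    calc _ ≤ ∑ j ∈ Finset.range (max J J'),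
          (irreducibles hd j).card * Real.exp (-((bridgeRate hd + l) * j)) := by
          refine Finset.sum_le_sum_of_subset_of_nonneg ?_ fun _ _ _ => by positivity
          exact Finset.range_subset_range.2 (le_max_right _ _)
      _ = ∑ j ∈ Finset.range (max J J'), p j -
          ∑ j ∈ Finset.range (max J J'), p j * (1 - Real.exp (-(l * j))) := by
          rw [← Finset.sum_sub_distrib]
          exact Finset.sum_congr rfl fun j _ => e1 j
      _ ≤ 1 - ∑ j ∈ Finset.range J, p j * (1 - Real.exp (-(l * j))) := by
          refine sub_le_sub (sum_irreducibles_le_one hd _) ?_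
          refine Finset.sum_le_sum_of_subset_of_nonneg
            (Finset.range_subset_range.2 (le_max_left _ _)) fun j _ _ => ?_
          exact mul_nonneg (hp0 j) (by linarith [hexp j])
      _ ≤ 1 - ∑ j ∈ Finset.range J, l / 2 * (j * p j) := by
          refine sub_le_sub_left (Finset.sum_le_sum fun j hj => ?_) _
          have hjJ : (j : ℝ) ≤ J + 1 := by
            have : (j : ℝ) ≤ J := by exact_mod_cast (Finset.mem_range.1 hj).le
            linarith
          have h1 := one_sub_exp_neg_ge (t := l * j) (by positivity) (by
            rw [hl, one_div, inv_mul_le_iff₀ (by positivity)]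
            linarith)
          calc l / 2 * (j * p j) = p j * (l * j / 2) := by ring
            _ ≤ _ := mul_le_mul_of_nonneg_left h1 (hp0 j)
      _ ≤ A := by
          rw [← Finset.mul_sum, hAdef]
          have h2 := mul_le_mul_of_nonneg_left hJ.le (half_pos hl0).le
          have h3 : l / 2 * (4 / δ) = l * (2 / δ) := by ring
          linarith
  have hA0 : 0 ≤ A := le_trans (by simp) (hA 0)
  have hAexp : A ≤ Real.exp (-(l * (2 / δ))) := by
    have := Real.add_one_le_exp (-(l * (2 / δ)))
    linarith
  -- For each `r ≥ δ n`, the factor `A ^ r ≤ exp (-2 l n)` turns `β + l` into `β - l`. Of this gain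
  -- `l`, half is lost to the lower bound on the number of bridges and a quarter to the `n + 1`
  -- values of `r`.
  refine IsExpSmall.of_le_const_mul (C := 4 / l) (c := l / 4) (by positivity) ?_
  filter_upwards [eventually_exp_le_card_bridges hd (half_pos hl0)] with n hn
  have hn0 : (0 : ℝ) ≤ n := Nat.cast_nonneg n
  have hsub : ((bridges hd n).filter fun w => δ * n ≤ (renewals n (profile hd w)).card) ⊆
      ((Finset.range (n + 1)).filter fun r : ℕ => δ * n ≤ r).biUnion fun r =>
        (bridges hd n).filter fun w => (renewals n (profile hd w)).card = r := by
    intro w hw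
    obtain ⟨h1, h2⟩ := Finset.mem_filter.1 hw
    refine Finset.mem_biUnion.2 ⟨(renewals n (profile hd w)).card, Finset.mem_filter.2
      ⟨Finset.mem_range.2 (Nat.lt_succ_of_le (card_renewals_le _ _)), h2⟩,
      Finset.mem_filter.2 ⟨h1, rfl⟩⟩
  have h1 : ((bridges hd n).filter fun w => δ * n ≤ (renewals n (profile hd w)).card).card ≤
      ∑ r ∈ (Finset.range (n + 1)).filter fun r : ℕ => δ * n ≤ r, numRenewals hd n r :=
    (Finset.card_le_card hsub).trans Finset.card_biUnion_le
  have h2 : ∀ r ∈ (Finset.range (n + 1)).filter fun r : ℕ => δ * n ≤ r,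
      (numRenewals hd n r : ℝ) ≤ Real.exp ((bridgeRate hd - l) * n) := by
    intro r hr
    have hr' := (Finset.mem_filter.1 hr).2
    calc (numRenewals hd n r : ℝ) ≤ A ^ r * Real.exp ((bridgeRate hd + l) * n) :=
          numRenewals_le hd hA0 hA n r
      _ ≤ Real.exp (-(l * (2 / δ))) ^ r * Real.exp ((bridgeRate hd + l) * n) := by gcongr
      _ = Real.exp (r * (-(l * (2 / δ))) + (bridgeRate hd + l) * n) := by
          rw [← Real.exp_nat_mul, ← Real.exp_add]
      _ ≤ _ := by
          rw [Real.exp_le_exp]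
          have h3 := mul_le_mul_of_nonneg_left hr' (by positivity : 0 ≤ l * (2 / δ))
          have h4 : l * (2 / δ) * (δ * n) = 2 * (l * n) := by field_simp
          linarith
  have h5 : (n : ℝ) + 1 ≤ 4 / l * Real.exp (l / 4 * n) := by
    rw [div_mul_eq_mul_div, le_div_iff₀ hl0]
    have := Real.add_one_le_exp (l / 4 * n)
    nlinarith
  have h6 : (((bridges hd n).filter fun w => δ * n ≤
      (renewals n (profile hd w)).card).card : ℝ) ≤
      (n + 1) * Real.exp ((bridgeRate hd - l) * n) := by
    calc _ ≤ ∑ r ∈ (Finset.range (n + 1)).filter fun r : ℕ => δ * n ≤ r,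
          (numRenewals hd n r : ℝ) := by exact_mod_cast h1
      _ ≤ ((Finset.range (n + 1)).filter fun r : ℕ => δ * n ≤ r).card •
          Real.exp ((bridgeRate hd - l) * n) := Finset.sum_le_card_nsmul _ _ _ h2
      _ ≤ _ := by
          rw [nsmul_eq_mul]
          gcongr
          have := Finset.card_filter_le (Finset.range (n + 1)) fun r : ℕ => δ * n ≤ r
          rw [Finset.card_range] at this
          exact_mod_cast this
  calc _ ≤ _ := h6
    _ ≤ (4 / l * Real.exp (l / 4 * n)) * Real.exp ((bridgeRate hd - l) * n) := by gcongr
    _ = 4 / l * Real.exp (-(l / 4 * n)) * Real.exp ((bridgeRate hd - l / 2) * n) := by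
        rw [mul_assoc, mul_assoc, ← Real.exp_add, ← Real.exp_add]; ring_nf
    _ ≤ _ := by gcongr

/-- If ballistic behaviour is not exponentially unlikely, irreducible bridges have finite mean
length. -/
lemma exists_sum_irreducibles_le (hd : 2 ≤ d) {v : ℝ} (hv : 0 < v)
    (h : ¬ IsExpSmall hd fun n w => v * n ≤ (profile hd w n : ℝ)) :
    ∃ K : ℝ, ∀ J, ∑ j ∈ Finset.range J,
      (j : ℝ) * ((irreducibles hd j).card * Real.exp (-(bridgeRate hd * j))) ≤ K := by
  by_contra! hc
  exact h (isExpSmall_ballistic (fun δ hδ => isExpSmall_renewals hd hc hδ) hv)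

/-! ### Walks indexed by `Fin (n + 1)` -/

/-- Extend a finite walk by keeping it constant. -/
def extend {n : ℕ} (γ : Fin (n + 1) → Fin d → ℤ) (i : ℕ) : Fin d → ℤ :=
  γ ⟨min i n, Nat.lt_succ_of_le (min_le_right i n)⟩

/-- The positions of a walk up to time `n`. -/
def restrict (n : ℕ) (w : ℕ → Fin d → ℤ) (i : Fin (n + 1)) : Fin d → ℤ := w i

lemma extend_apply {n : ℕ} (γ : Fin (n + 1) → Fin d → ℤ) (i : Fin (n + 1)) :
    extend γ i = γ i := by
  rw [extend]
  congr 1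
  ext
  exact min_eq_left (Nat.lt_succ_iff.1 i.2)

lemma restrict_extend {n : ℕ} (γ : Fin (n + 1) → Fin d → ℤ) : restrict n (extend γ) = γ :=
  funext fun i => extend_apply γ i

lemma restrict_mem_SAW {n : ℕ} {w : ℕ → Fin d → ℤ} (hw : IsWalk d n w) :
    restrict n w ∈ SAW d n := by
  refine ⟨hw.zero, fun i => hw.bond i i.2, fun i j e => ?_⟩
  rcases lt_trichotomy i j with h | h | h
  · exact absurd e (hw.inj i j h (Nat.lt_succ_iff.1 j.2))
  · exact h
  · exact absurd e.symm (hw.inj j i h (Nat.lt_succ_iff.1 i.2))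

lemma isWalk_extend {n : ℕ} {γ : Fin (n + 1) → Fin d → ℤ} (hγ : γ ∈ SAW d n) :
    IsWalk d n (extend γ) where
  zero := (extend_apply γ 0).trans hγ.1
  bond i hi := by
    have h1 := extend_apply γ (Fin.castSucc ⟨i, hi⟩)
    have h2 := extend_apply γ (Fin.succ ⟨i, hi⟩)
    simp only [Fin.val_castSucc, Fin.val_succ] at h1 h2
    rw [h1, h2]
    exact hγ.2.1 ⟨i, hi⟩
  inj i j hij hj e := by
    have h1 := extend_apply γ ⟨i, by omega⟩
    have h2 := extend_apply γ ⟨j, by omega⟩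
    simp only at h1 h2
    rw [h1, h2] at e
    have := hγ.2.2 e
    rw [Fin.mk.injEq] at this
    omega
  frozen i hi := by simp [extend, hi]

lemma restrict_injOn (n : ℕ) : Set.InjOn (restrict n) {w | IsWalk d n w} := by
  intro w hw w' hw' e
  exact IsWalk.ext hw hw' fun i hi => congrFun e ⟨i, Nat.lt_succ_of_le hi⟩

lemma restrict_mem_SAB {hd : 2 ≤ d} {n : ℕ} {w : ℕ → Fin d → ℤ} (hw : IsBridge hd n w) :
    restrict n w ∈ SAB hd n := by
  refine ⟨restrict_mem_SAW hw.walk, fun j hj hjn => ?_, fun j _ hjn => ?_⟩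
  · have h1 := hw.pos j hj (Nat.lt_succ_iff.1 j.2)
    rwa [← hw.isProfile.zero] at h1
  · exact hw.le_last j (Nat.lt_succ_iff.1 j.2)

lemma profile_extend {hd : 2 ≤ d} {n : ℕ} (γ : Fin (n + 1) → Fin d → ℤ) {i : ℕ} (hi : i ≤ n) :
    profile hd (extend γ) i = y hd (γ ⟨i, Nat.lt_succ_of_le hi⟩) := by
  rw [← extend_apply γ, profile]

lemma isBridge_extend {hd : 2 ≤ d} {n : ℕ} {γ : Fin (n + 1) → Fin d → ℤ} (hγ : γ ∈ SAB hd n) :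
    IsBridge hd n (extend γ) where
  walk := isWalk_extend hγ.1
  pos j hj hjn := by
    have h1 := hγ.2.1 ⟨j, Nat.lt_succ_of_le hjn⟩ hj hjn
    rw [hγ.1.1] at h1
    rw [profile_extend γ hjn]
    simpa [y] using h1
  le_last j hjn := by
    rw [profile_extend γ hjn, profile_extend γ le_rfl]
    exact hγ.2.2 ⟨j, Nat.lt_succ_of_le hjn⟩ (Nat.zero_le j) hjn

lemma extend_mem_irreducibles {hd : 2 ≤ d} {n : ℕ} {γ : Fin (n + 1) → Fin d → ℤ}
    (hγ : γ ∈ SAB hd n) (hi : IsIrreducible hd γ) : extend γ ∈ irreducibles hd n := by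
  have hb := isBridge_extend hγ
  rw [irreducibles, Finset.mem_filter, mem_bridges, card_renewals_eq_one_iff hb.isProfile]
  refine ⟨hb, hi.1, fun k hk hr => ?_⟩
  have hkn := hr.1
  refine hi.2 ⟨k, by omega⟩ hk (by simp only; omega) ⟨⟨k, by omega⟩, rfl, ⟨?_, ?_⟩, ?_, ?_⟩
  · intro j hj hjk
    exact hγ.2.1 j hj (Fin.le_last j)
  · intro j _ hjk
    have := hr.2.1 j hjk
    rwa [profile_extend γ (Nat.lt_succ_iff.1 j.2), profile_extend γ hkn.le] at this
  · intro j hj _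
    have := hr.2.2 j hj (Nat.lt_succ_iff.1 j.2)
    rwa [profile_extend γ (Nat.lt_succ_iff.1 j.2), profile_extend γ hkn.le] at this
  · intro j _ _
    exact hγ.2.2 j (Fin.zero_le j) (Fin.le_last j)

/-! ### Translation to the connective constant and to the laws -/

lemma ncard_SAW (d n : ℕ) : (SAW d n).ncard = (walks d n).card := by
  classical
  have h1 : SAW d n = ((walks d n).image (restrict n) : Finset _) := by
    ext γ
    simp only [Finset.coe_image, Set.mem_image, Finset.mem_coe, mem_walks]
    constructor
    · exact fun h => ⟨extend γ, isWalk_extend h, restrict_extend γ⟩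
    · rintro ⟨w, hw, rfl⟩
      exact restrict_mem_SAW hw
  rw [h1, Set.ncard_coe_finset, Finset.card_image_of_injOn]
  exact (restrict_injOn n).mono fun w hw => mem_walks.1 hw

lemma connectiveConstant_eq (hd : 2 ≤ d) : connectiveConstant d = Real.exp (walkRate hd) := by
  refine Tendsto.limUnder_eq ?_
  refine ((Real.continuous_exp.tendsto _).comp (tendsto_walkRate hd)).congr fun n => ?_
  have hn : (0 : ℝ) < (walks d n).card := by exact_mod_cast card_walks_pos hd n
  rw [Function.comp_apply, ncard_SAW, Real.rpow_def_of_pos hn, mul_one_div]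

open Classical in
lemma lawSAB_height (hd : 2 ≤ d) (n : ℕ) (t : ℝ) :
    lawSAB hd n {γ | t ≤ (y hd (γ (Fin.last n)) : ℝ)} = ((bridges hd n).card : ℝ≥0∞)⁻¹ *
      ((bridges hd n).filter fun w => t ≤ (profile hd w n : ℝ)).card := by
  have hinj : Set.InjOn (restrict n) (bridges hd n : Set (ℕ → Fin d → ℤ)) :=
    (restrict_injOn n).mono fun w hw => (mem_bridges.1 hw).walk
  have h1 : SAB hd n = ((bridges hd n).image (restrict n) : Finset _) := by
    ext γ
    simp only [Finset.coe_image, Set.mem_image, Finset.mem_coe, mem_bridges]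
    constructor
    · exact fun h => ⟨extend γ, isBridge_extend h, restrict_extend γ⟩
    · rintro ⟨w, hw, rfl⟩
      exact restrict_mem_SAB hw
  have h2 : SAB hd n ∩ {γ | t ≤ (y hd (γ (Fin.last n)) : ℝ)} =
      (((bridges hd n).filter fun w => t ≤ (profile hd w n : ℝ)).image (restrict n) :
        Finset _) := by
    rw [h1]
    ext γ
    simp only [Finset.coe_image, Set.mem_inter_iff, Set.mem_image, Finset.mem_coe,
      Finset.mem_filter, Set.mem_ofPred_eq]
    constructor
    · rintro ⟨⟨w, hw, rfl⟩, ht⟩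
      exact ⟨w, ⟨hw, ht⟩, rfl⟩
    · rintro ⟨w, ⟨hw, ht⟩, rfl⟩
      exact ⟨⟨w, hw, rfl⟩, ht⟩
  rw [lawSAB, uniformOn, cond_apply (by rw [h1]; exact Finset.measurableSet _), h2, h1,
    Measure.count_apply_finset, Measure.count_apply_finset, Finset.card_image_of_injOn hinj,
    Finset.card_image_of_injOn (hinj.mono (by exact_mod_cast Finset.filter_subset _ _))]

/-- Exponential smallness at rate `c` would force the limsup to be at most `-c < 0`. -/
lemma not_isExpSmall_of_limsup (hd : 2 ≤ d) {v : ℝ}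
    (h : limsup (fun n : ℕ => (n : EReal)⁻¹ *
      ENNReal.log (lawSAB hd n {γ | v * n ≤ (y hd (γ (Fin.last n)) : ℝ)})) atTop = 0) :
    ¬ IsExpSmall hd fun n w => v * n ≤ (profile hd w n : ℝ) := by
  classical
  rintro ⟨c, hc, hs⟩
  have hle : limsup (fun n : ℕ => (n : EReal)⁻¹ *
      ENNReal.log (lawSAB hd n {γ | v * n ≤ (y hd (γ (Fin.last n)) : ℝ)})) atTop ≤
      ((-c : ℝ) : EReal) := by
    refine limsup_le_of_le (by isBoundedDefault) ?_
    filter_upwards [hs, eventually_gt_atTop 0] with n hn hn0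
    have hb : 0 < (bridges hd n).card := card_bridges_pos hd n
    have hb' : (0 : ℝ) < (bridges hd n).card := by exact_mod_cast hb
    have hn0' : (0 : ℝ) < n := by exact_mod_cast hn0
    have h1 : lawSAB hd n {γ | v * n ≤ (y hd (γ (Fin.last n)) : ℝ)} ≤
        ENNReal.ofReal (Real.exp (-(c * n))) := by
      rw [lawSAB_height, mul_comm, ← div_eq_mul_inv]
      refine ENNReal.div_le_of_le_mul ?_
      rw [← ENNReal.ofReal_natCast, ← ENNReal.ofReal_natCast (bridges hd n).card,
        ← ENNReal.ofReal_mul (Real.exp_pos _).le]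
      exact ENNReal.ofReal_le_ofReal (by convert hn)
    have h2 : ENNReal.log (lawSAB hd n {γ | v * n ≤ (y hd (γ (Fin.last n)) : ℝ)}) ≤
        ((-(c * n) : ℝ) : EReal) := by
      refine (ENNReal.log_le_log h1).trans_eq ?_
      rw [ENNReal.log_ofReal_of_pos (Real.exp_pos _), Real.log_exp]
    have h3 : (n : EReal)⁻¹ = (((n : ℝ)⁻¹ : ℝ) : EReal) := by
      rw [EReal.coe_inv]
      rfl
    rw [h3]
    refine (mul_le_mul_of_nonneg_left h2 (by exact_mod_cast (inv_pos.2 hn0').le)).trans_eq ?_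
    rw [← EReal.coe_mul]
    congr 1
    field_simp
  rw [h] at hle
  have : (0 : ℝ) ≤ -c := by exact_mod_cast hle
  linarith

lemma lintegral_length_lt_top (hd : 2 ≤ d) {K : ℝ} (hK : ∀ J, ∑ j ∈ Finset.range J,
      (j : ℝ) * ((irreducibles hd j).card * Real.exp (-(bridgeRate hd * j))) ≤ K) :
    ∫⁻ γ : ISAB hd, (γ.length : ℝ≥0∞) ∂(lawISAB hd) < ∞ := by
  set g : ℕ → ℝ≥0∞ := fun n => ENNReal.ofReal ((connectiveConstant d)⁻¹ ^ n) * n with hg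
  have h1 : ∫⁻ γ : ISAB hd, (γ.length : ℝ≥0∞) ∂(lawISAB hd) = ∑' γ : ISAB hd, g γ.length := by
    rw [lawISAB, lintegral_sum_measure]
    refine tsum_congr fun γ => ?_
    rw [lintegral_smul_measure, lintegral_dirac' _ (measurable_from_top), smul_eq_mul]
  set e : ISAB hd → Σ n : ℕ, {w // w ∈ irreducibles hd n} := fun γ =>
    ⟨γ.1.1, extend γ.1.2, extend_mem_irreducibles γ.2.1 γ.2.2⟩ with he
  have hinj : Function.Injective e := by
    rintro ⟨⟨n, γ⟩, h⟩ ⟨⟨n', γ'⟩, h'⟩ hee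
    simp only [he, Sigma.mk.injEq] at hee
    obtain ⟨rfl, h2⟩ := hee
    have h3 := congrArg Subtype.val (eq_of_heq h2)
    simp only at h3
    have h4 := congrArg (restrict n) h3
    rw [restrict_extend, restrict_extend] at h4
    subst h4
    rfl
  rw [h1]
  calc ∑' γ : ISAB hd, g γ.length = ∑' γ : ISAB hd, (fun x : Σ n : ℕ, {w // w ∈ irreducibles hd n} =>
        g x.1) (e γ) := rfl
    _ ≤ ∑' x : Σ n : ℕ, {w // w ∈ irreducibles hd n}, g x.1 :=
        ENNReal.tsum_comp_le_tsum_of_injective hinj _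
    _ = ∑' n, ((irreducibles hd n).card : ℝ≥0∞) * g n := by
        rw [ENNReal.tsum_sigma fun n (_ : {w // w ∈ irreducibles hd n}) => g n]
        refine tsum_congr fun n => ?_
        rw [tsum_fintype, Finset.sum_const, nsmul_eq_mul, Finset.card_univ, Fintype.card_coe]
    _ ≤ ENNReal.ofReal K := by
        rw [ENNReal.tsum_eq_iSup_nat]
        refine iSup_le fun J => ?_
        have h5 : ∀ n : ℕ, ((irreducibles hd n).card : ℝ≥0∞) * g n ≤ ENNReal.ofReal ((n : ℝ) *
            ((irreducibles hd n).card * Real.exp (-(bridgeRate hd * n)))) := by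
          intro n
          simp only [hg]
          rw [← ENNReal.ofReal_natCast, ← ENNReal.ofReal_natCast n,
            ← ENNReal.ofReal_mul (by rw [connectiveConstant_eq hd]; positivity),
            ← ENNReal.ofReal_mul (Nat.cast_nonneg _)]
          refine ENNReal.ofReal_le_ofReal ?_
          -- This is where the weights pass from the walk rate to the smaller or equal bridge rate.
          have h6 : (connectiveConstant d)⁻¹ ^ n ≤ Real.exp (-(bridgeRate hd * n)) := by
            rw [connectiveConstant_eq hd, ← Real.exp_neg, ← Real.exp_nat_mul, Real.exp_le_exp]
            have := mul_le_mul_of_nonneg_right (bridgeRate_le_walkRate hd) (Nat.cast_nonneg (α := ℝ) n)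
            linarith
          calc _ = (n : ℝ) * ((irreducibles hd n).card * (connectiveConstant d)⁻¹ ^ n) := by ring
            _ ≤ _ := by gcongr
        refine (Finset.sum_le_sum fun n _ => h5 n).trans ?_
        rw [← ENNReal.ofReal_sum_of_nonneg fun n _ => by positivity]
        exact ENNReal.ofReal_le_ofReal (hK J)
    _ < ∞ := ENNReal.ofReal_lt_top

end SelfAvoiding

theorem corollary2p4 (d : ℕ) (hd : 2 ≤ d) (h : SelfAvoiding.BallisticAssumption hd) :
    ∫⁻ γ : SelfAvoiding.ISAB hd, (γ.length : ℝ≥0∞) ∂(SelfAvoiding.lawISAB hd) < ∞ := by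
  obtain ⟨v, hv, h⟩ := h
  obtain ⟨K, hK⟩ := SelfAvoiding.exists_sum_irreducibles_le hd hv
    (SelfAvoiding.not_isExpSmall_of_limsup hd h)
  exact SelfAvoiding.lintegral_length_lt_top hd hK
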